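/- **Setting.** Let $S$ be a finite lattice of states and $A$ a finite totally ordered set of actions, $|A|\ge 2$. Let $\mathcal P(S)$ be the set of probability vectors on $S$ (mean fields) with first-order stochastic dominance $\preceq$ and $\|z-z'\|_1=\sum_s|z(s)-z'(s)|$. A game consists of rewards $r(s,a,z)\in[-1,1]$, transition laws $P(\cdot\mid s,a,z)\in\mathcal P(S)$ for $z\in\mathcal P(S)$, a discount factor $\gamma\in[0,1)$, a tremble $\epsilon>0$ with $\epsilon/(|A|-1)<1-\epsilon$, a regeneration probability $\zeta\in[0,1]$ and a regeneration law $\Psi\in\mathcal P(S)$. A strategy $\mu$ gives probabilities $\mu(s,a)$, and $P_{z,\mu}(s'\mid s)=\sum_a\mu(s,a)P(s'\mid s,a,z)$. The McKean–Vlasov update is $$\Phi(z,\mu)(s')=(1-\zeta)\sum_s z(s)P_{z,\mu}(s'\mid s)+\zeta\,\Psi(s').$$ The trembling-hand strategies are those with $\mu(s,a)\ge\epsilon/(|A|-1)$ for all $s,a$. For a fixed mean field $z$ let $V_{\mu,z}(s)=\mathbb E_\mu[\sum_{t\ge0}\gamma^t r(s_t,a_t,z)\mid s_0=s]$, with $s_{t+1}\sim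 P(\cdot\mid s_t,a_t,z)$; let $V^*_z(s)$ be its supremum over trembling-hand strategies and $Q^*_z(s,a)=r(s,a,z)+\gamma\sum_{s'}P(s'\mid s,a,z)V^*_z(s')$. For $Q:S\times A\to\mathbb R$ let $\pi^\epsilon_Q(s,\cdot)$ put mass $1-\epsilon$ on the largest maximizer of $Q(s,\cdot)$ and $\epsilon/(|A|-1)$ on every other action, and let $G(Q)(s)=\sum_a\pi^\epsilon_Q(s,a)Q(s,a)$. A pair $(z^*,\mu^*)$ is a T-MFE if $\mu^*$ is trembling-hand, $V_{\mu^*,z^*}(s)\ge V_{\nu,z^*}(s)$ for all $s$ and all trembling-hand $\nu$, and $z^*=\Phi(z^*,\mu^*)$. *Strategic complementarities.* $r$ is non-decreasing in $s$, supermodular in $(s,a)$, and has increasing differences in $(s,a)$ and $z$; $P(\cdot\mid s,a,z)$ is stochastically non-decreasing in $s,a,z$, stochastically supermodular in $(s,a)$, and has stochastically increasing differences in $(s,a)$ and $z$. *Lipschitz assumption.* There are $C_1,C_2,C_3\ge0$ such that for all $s,a,z,z'$ and all $Q:S\times A\to\mathbb R$: $|r(s,a,z)-r(s,a,z')|\le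 C_1\|z-z'\|_1$; $\|P(\cdot\mid s,a,z)-P(\cdot\mid s,a,z')\|_1\le C_2\|z-z'\|_1$; and $\|P_{z,\mu}(\cdot\mid s)-P_{z,\mu'}(\cdot\mid s)\|_1\le C_3\|Q^*_{z'}-Q\|_\infty$ for $\mu=\pi^\epsilon_{Q^*_{z'}}$, $\mu'=\pi^\epsilon_Q$. **Algorithms.** Both start from $z_0,\mu_0$ with $z_1=\Phi(z_0,\mu_0)$, and $z_{k+1}=\Phi(z_k,\mu_{k-1})$ for $k\ge1$. - *Modified T-BR* (iterates $\bar z_k,\bar\mu_k$): $\bar\mu_k=\pi^\epsilon_{Q^*_{\bar z_k}}$ for $k\ge1$. - *Online TMFQ-learning with synchronous TQ-learning* ($I_0$ updates per iteration, exponent $w$): for $k\ge1$, $\mu_k=\pi^\epsilon_{Q_{I_0}}$, where $Q_0=0$ and, for $0\le t<I_0$ and all $(s,a)$ simultaneously, $$Q_{t+1}(s,a)=(1-\alpha_t)Q_t(s,a)+\alpha_t\bigl(r(s,a,z_k)+\gamma\,G(Q_t)(s'_{s,a})\bigr),\qquad \alpha_t=(t+1)^{-w},$$ with fresh independent samples $s'_{s,a}\sim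 P(\cdot\mid s,a,z_k)$. **Theorem.** Let $w\in(1/2,1)$. There is a constant $c>0$ depending only on $w$ such that for every game with strategic complementarities that satisfies the Lipschitz assumption the following holds. 1. If $z_0\preceq z$ for all $z\in\mathcal P(S)$, and $\mu_0(s,\cdot)$ is stochastically non-decreasing in $s$ with $\mu_0(s,\cdot)\preceq\pi^\epsilon_{Q^*_{z_0}}(s,\cdot)$ for all $s$, then modified T-BR converges: there is $z^*$ such that $(z^*,\pi^\epsilon_{Q^*_{z^*}})$ is a T-MFE and $\|\bar z_k-z^*\|_1\to0$. 2. Let $z_0,\mu_0$ be any common initialization of the two algorithms, $(z^*,\mu^*)$ a T-MFE, $\bar\epsilon,\delta\in(0,1)$, and $k_0=k_0(\bar\epsilon)\in\mathbb N$ such that $\|\bar z_{k_0}-z^*\|_1\le\bar\epsilon$. Put $V_{\max}=\frac1{1-\gamma}$, $\beta=\frac{1-\gamma}2$, $D=\frac{C_1}{1-\gamma}+\frac{\gamma C_2}{(1-\gamma)^2}$, $M=\max\{1+C_2,\,C_3D\}$ and $B=\max\bigl\{1,\ (1-\zeta)C_3\sum_{j=0}^{k_0-1}(2(1-\zeta)M)^j\bigr\}$.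 If $$I_0\ \ge\ c\left[\left(\frac{V_{\max}^2B^2\ln\!\bigl(\frac{2k_0|S||A|V_{\max}B}{\delta\beta\bar\epsilon}\bigr)}{\beta^2\bar\epsilon^2}\right)^{1/w}+\left(\frac1\beta\ln\frac{V_{\max}B}{\bar\epsilon}\right)^{1/(1-w)}\right]$$ (for $k_0=0$ the first summand is read as $0$), then online TMFQ-learning with $I_0$ synchronous TQ-learning updates per iteration satisfies $$\mathbb P\bigl(\|z_{k_0}-z^*\|_1\le2\bar\epsilon\bigr)\ge1-\delta.$$ -/

import Mathlib

open scoped ENNReal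

noncomputable section

namespace TMFG

/-- Mean fields: probability vectors on the finite state space. -/
abbrev MeanField (S : Type*) [Fintype S] := stdSimplex ℝ S

/-- Randomized stationary strategies: `μ s a` is the probability of action `a` in state `s`. -/
abbrev Strategy (S A : Type*) [Fintype A] := S → stdSimplex ℝ A

/-- The `ℓ¹` distance of two probability vectors. -/
def l1Dist {X : Type*} [Fintype X] (p q : stdSimplex ℝ X) : ℝ := ∑ x, |p x - q x|

/-- Expectation of `f` under the probability vector `p`. -/
def expect {X : Type*} [Fintype X] (p : stdSimplex ℝ X) (f : X → ℝ) : ℝ := ∑ x, p x * f x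

/-- First-order stochastic dominance `p ⪯_SD q`. -/
def SDLe {X : Type*} [Fintype X] [Preorder X] (p q : stdSimplex ℝ X) : Prop :=
  ∀ f : X → ℝ, Monotone f → expect p f ≤ expect q f

/-- A mean field game with finitely many states and actions, together with the tremble `ε`
and the regeneration mechanism of the population: in every round each player is replaced, with
probability `ζ`, by a fresh one whose state is drawn from `regen`. -/
structure Game (S A : Type*) [Fintype S] [Fintype A] where
  /-- reward `r(s, a, z)` -/
  reward : S → A → MeanField S → ℝ
  /-- transition kernel `P(· | s, a, z)` -/
  trans : S → A → MeanField S → stdSimplex ℝ S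
  /-- discount factor `γ` -/
  γ : ℝ
  /-- tremble -/
  ε : ℝ
  /-- regeneration probability -/
  ζ : ℝ
  /-- law of the state of a regenerated player -/
  regen : stdSimplex ℝ S
  abs_reward_le : ∀ s a z, |reward s a z| ≤ 1
  γ_nonneg : 0 ≤ γ
  γ_lt_one : γ < 1
  ε_pos : 0 < ε
  ε_small : ε / ((Fintype.card A : ℝ) - 1) < 1 - ε
  ζ_nonneg : 0 ≤ ζ
  ζ_le_one : ζ ≤ 1

section Greedy

variable {S A : Type*} [Fintype A]

/-- The maximizers of `Q(s, ·)`. -/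
def argmaxSet (Q : S → A → ℝ) (s : S) : Finset A :=
  Finset.univ.filter fun a => ∀ b, Q s b ≤ Q s a

theorem argmaxSet_nonempty [Nonempty A] (Q : S → A → ℝ) (s : S) : (argmaxSet Q s).Nonempty := by
  obtain ⟨a, ha⟩ := Finite.exists_max (Q s)
  exact ⟨a, by simp [argmaxSet, ha]⟩

/-- The largest maximizer of `Q(s, ·)`. -/
def greedy [LinearOrder A] [Nonempty A] (Q : S → A → ℝ) (s : S) : A :=
  (argmaxSet Q s).max' (argmaxSet_nonempty Q s)

end Greedy

namespace Game

variable {S A : Type*} [Fintype S] [Fintype A] (g : Game S A)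

/-- Transition law out of `s` when actions are drawn from `μ`: `P_{z,μ}(s' | s)`. -/
def transUnder (z : MeanField S) (μ : Strategy S A) (s s' : S) : ℝ :=
  ∑ a, μ s a * g.trans s a z s'

/-- McKean–Vlasov update `Φ(z, μ)` of a population with regeneration. -/
def Phi (z : MeanField S) (μ : Strategy S A) : MeanField S :=
  ⟨fun s' => (1 - g.ζ) * ∑ s, z s * g.transUnder z μ s s' + g.ζ * g.regen s', by
    constructor
    · intro s'
      have h1 : 0 ≤ 1 - g.ζ := sub_nonneg.2 g.ζ_le_one
      have h2 : 0 ≤ ∑ s, z s * g.transUnder z μ s s' :=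
        Finset.sum_nonneg fun s _ => mul_nonneg (stdSimplex.zero_le z s)
          (Finset.sum_nonneg fun a _ => mul_nonneg (stdSimplex.zero_le (μ s) a)
            (stdSimplex.zero_le (g.trans s a z) s'))
      exact add_nonneg (mul_nonneg h1 h2)
        (mul_nonneg g.ζ_nonneg (stdSimplex.zero_le g.regen s'))
    · have h : ∀ s, ∑ s', g.transUnder z μ s s' = 1 := by
        intro s
        unfold transUnder
        rw [Finset.sum_comm]
        simp [← Finset.mul_sum]
      have h' : ∑ s', ∑ s, z s * g.transUnder z μ s s' = 1 := by
        rw [Finset.sum_comm]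
        simp [← Finset.mul_sum, h]
      rw [Finset.sum_add_distrib, ← Finset.mul_sum, ← Finset.mul_sum, h',
        stdSimplex.sum_eq_one]
      ring⟩

/-- `E[r(s_t, a_t, z) | s_0 = s]` for a player who follows `μ` while the mean field stays
at `z`. -/
def rewardAt (z : MeanField S) (μ : Strategy S A) : ℕ → S → ℝ
  | 0, s => ∑ a, μ s a * g.reward s a z
  | t + 1, s => ∑ a, μ s a * ∑ s', g.trans s a z s' * rewardAt z μ t s'

/-- Discounted value `V_{μ,z}(s)`. -/
def value (z : MeanField S) (μ : Strategy S A) (s : S) : ℝ :=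
  ∑' t : ℕ, g.γ ^ t * g.rewardAt z μ t s

/-- The trembling-hand strategies: each action has probability at least `ε / (|A| - 1)`. -/
def trembling : Set (Strategy S A) :=
  {μ | ∀ s a, g.ε / ((Fintype.card A : ℝ) - 1) ≤ μ s a}

/-- Optimal trembling-hand value `V*_z`. -/
def optValue (z : MeanField S) (s : S) : ℝ := ⨆ μ : g.trembling, g.value z μ s

/-- Optimal TQ-value function `Q*_z`. -/
def optQ (z : MeanField S) (s : S) (a : A) : ℝ :=
  g.reward s a z + g.γ * ∑ s', g.trans s a z s' * g.optValue z s'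

/-- `(z, μ)` is a trembling-hand-perfect mean field equilibrium: `μ` is an optimal trembling-hand
strategy against `z`, and `z` is stationary under `μ`. -/
def IsTMFE (z : MeanField S) (μ : Strategy S A) : Prop :=
  (μ ∈ g.trembling ∧ ∀ ν ∈ g.trembling, ∀ s, g.value z ν s ≤ g.value z μ s) ∧ z = g.Phi z μ

section Trembling

variable [LinearOrder A] [Nontrivial A]

/-- The trembling-hand strategy `π^ε_Q`: probability `1 - ε` on the largest maximizer of
`Q(s, ·)`, the rest spread evenly over the other actions. -/
def tremble (Q : S → A → ℝ) : Strategy S A := fun s =>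
  ⟨fun a => if a = greedy Q s then 1 - g.ε else g.ε / ((Fintype.card A : ℝ) - 1), by
    have hc : (1 : ℝ) < Fintype.card A := by exact_mod_cast Fintype.one_lt_card
    have hd : 0 < g.ε / ((Fintype.card A : ℝ) - 1) := div_pos g.ε_pos (by linarith)
    constructor
    · intro a
      dsimp only
      split_ifs
      · exact (hd.trans g.ε_small).le
      · exact hd.le
    · rw [Finset.sum_ite, Finset.filter_eq' Finset.univ, Finset.filter_ne' Finset.univ]
      simp only [Finset.mem_univ, if_true, Finset.sum_const, Finset.card_singleton, one_smul,
        Finset.card_erase_of_mem, Finset.card_univ, nsmul_eq_mul]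
      rw [Nat.cast_sub Fintype.card_pos, Nat.cast_one]
      field_simp [show (Fintype.card A : ℝ) - 1 ≠ 0 by linarith]
      ring⟩

/-- `G(Q)(s)`, the mean of `Q(s, ·)` under `π^ε_Q`. -/
def G (Q : S → A → ℝ) (s : S) : ℝ := ∑ a, g.tremble Q s a * Q s a

/-- The trembling-hand best response `π^ε_{Q*_z}` to a mean field. -/
def bestResponse (z : MeanField S) : Strategy S A := g.tremble (g.optQ z)

/-- One round of modified T-BR, on pairs `(z_k, μ_{k-1})`: the strategy computed at `z_k` is
stored, while the mean field moves with the previous one. -/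
def modStep (x : MeanField S × Strategy S A) : MeanField S × Strategy S A :=
  (g.Phi x.1 x.2, g.bestResponse x.1)

/-- Modified T-BR. Its first mean-field update can use only the initial strategy `μ₀`; for
`k ≥ 1`, `z_{k+1} = Φ(z_k, μ_{k-1})` and `μ_k = π^ε_{Q*_{z_k}}`. The entry of index `k` is
`(z_k, μ_{k-1})`, with `μ₀` in place of `μ_{-1}`. -/
def modTBR (z₀ : MeanField S) (μ₀ : Strategy S A) : ℕ → MeanField S × Strategy S A
  | 0 => (z₀, μ₀)
  | 1 => (g.Phi z₀ μ₀, μ₀)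
  | k + 2 => g.modStep (modTBR z₀ μ₀ (k + 1))

/-- Law of one round of simulator samples: for all pairs `(s, a)` at once, independently,
a next state `σ (s, a) ∼ P(· | s, a, z)`. -/
def sampleLaw [DecidableEq S] (z : MeanField S) : PMF (S × A → S) :=
  PMF.ofFintype (fun σ => ∏ x : S × A, ENNReal.ofReal (g.trans x.1 x.2 z (σ x))) (by
    have h := Finset.prod_univ_sum (fun _ : S × A => (Finset.univ : Finset S))
      (fun x s' => ENNReal.ofReal (g.trans x.1 x.2 z s'))
    rw [Fintype.piFinset_univ] at h
    rw [← h]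
    refine Finset.prod_eq_one fun x _ => ?_
    rw [← ENNReal.ofReal_sum_of_nonneg fun s' _ => stdSimplex.zero_le _ s',
      stdSimplex.sum_eq_one, ENNReal.ofReal_one])

/-- One synchronous TQ-learning update with step size `α` and sampled next states `σ`. -/
def tqUpdate (z : MeanField S) (α : ℝ) (Q : S → A → ℝ) (σ : S × A → S) : S → A → ℝ :=
  fun s a => (1 - α) * Q s a + α * (g.reward s a z + g.γ * g.G Q (σ (s, a)))

/-- Law of the `t`-th iterate of synchronous TQ-learning at the fixed mean field `z`, started at
`Q = 0`, with step sizes `1 / (t + 1) ^ w`. -/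
def tqLaw [DecidableEq S] (w : ℝ) (z : MeanField S) : ℕ → PMF (S → A → ℝ)
  | 0 => PMF.pure 0
  | t + 1 => (tqLaw w z t).bind fun Q =>
      (g.sampleLaw z).map (g.tqUpdate z (1 / ((t : ℝ) + 1) ^ w) Q)

/-- Law of `(z_k, μ_{k-1})` in online TMFQ-learning with `I` synchronous TQ-learning updates per
iteration: for `k ≥ 1`, `Q_k` is the `I`-th TQ-learning iterate at the mean field `z_k`,
`μ_k = π^ε_{Q_k}` and `z_{k+1} = Φ(z_k, μ_{k-1})`. Same conventions as in `modTBR`. -/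
def onlineLaw [DecidableEq S] (w : ℝ) (I : ℕ) (z₀ : MeanField S) (μ₀ : Strategy S A) :
    ℕ → PMF (MeanField S × Strategy S A)
  | 0 => PMF.pure (z₀, μ₀)
  | 1 => PMF.pure (g.Phi z₀ μ₀, μ₀)
  | k + 2 => (onlineLaw w I z₀ μ₀ (k + 1)).bind fun x =>
      (g.tqLaw w x.1 I).map fun Q => (g.Phi x.1 x.2, g.tremble Q)

/-- The Lipschitz assumption. `‖Q‖` is the supremum norm. The third condition compares an
arbitrary `Q` with the optimal TQ-value functions only: as `π^ε_Q` is invariant under scaling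
of `Q`, demanding it of all pairs `Q₁, Q₂` would make the transitions independent of actions. -/
structure LipschitzAssumption (C₁ C₂ C₃ : ℝ) : Prop where
  C₁_nonneg : 0 ≤ C₁
  C₂_nonneg : 0 ≤ C₂
  C₃_nonneg : 0 ≤ C₃
  reward_lip : ∀ s a z z', |g.reward s a z - g.reward s a z'| ≤ C₁ * l1Dist z z'
  trans_lip : ∀ s a z z', l1Dist (g.trans s a z) (g.trans s a z') ≤ C₂ * l1Dist z z'
  strategy_lip : ∀ z z' (Q : S → A → ℝ) (s : S),
    ∑ s', |g.transUnder z (g.bestResponse z') s s' - g.transUnder z (g.tremble Q) s s'| ≤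
      C₃ * ‖g.optQ z' - Q‖

end Trembling

/-- Strategic complementarities. `S × A` has the product order, and mean fields are ordered by
first-order stochastic dominance. -/
structure StrategicComplementarities [Lattice S] [Lattice A] : Prop where
  reward_mono : ∀ a z, Monotone fun s => g.reward s a z
  reward_supermodular : ∀ z (x y : S × A),
    g.reward x.1 x.2 z + g.reward y.1 y.2 z ≤
      g.reward (x ⊔ y).1 (x ⊔ y).2 z + g.reward (x ⊓ y).1 (x ⊓ y).2 z
  reward_incDiff : ∀ z z', SDLe z z' → ∀ x y : S × A, x ≤ y →
    g.reward y.1 y.2 z - g.reward x.1 x.2 z ≤ g.reward y.1 y.2 z' - g.reward x.1 x.2 z'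
  trans_mono : ∀ z z', SDLe z z' → ∀ x y : S × A, x ≤ y →
    SDLe (g.trans x.1 x.2 z) (g.trans y.1 y.2 z')
  trans_supermodular : ∀ z (f : S → ℝ), Monotone f → ∀ x y : S × A,
    expect (g.trans x.1 x.2 z) f + expect (g.trans y.1 y.2 z) f ≤
      expect (g.trans (x ⊔ y).1 (x ⊔ y).2 z) f + expect (g.trans (x ⊓ y).1 (x ⊓ y).2 z) f
  trans_incDiff : ∀ z z', SDLe z z' → ∀ f : S → ℝ, Monotone f → ∀ x y : S × A, x ≤ y →
    expect (g.trans y.1 y.2 z) f - expect (g.trans x.1 x.2 z) f ≤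
      expect (g.trans y.1 y.2 z') f - expect (g.trans x.1 x.2 z') f

/-- `V_max = 1 / (1 - γ)`. -/
def Vmax : ℝ := 1 / (1 - g.γ)

/-- `β = (1 - γ) / 2`. -/
def β : ℝ := (1 - g.γ) / 2

/-- `D = C₁ / (1 - γ) + γ C₂ / (1 - γ)²`. -/
def constD (C₁ C₂ : ℝ) : ℝ := C₁ / (1 - g.γ) + g.γ * C₂ / (1 - g.γ) ^ 2

/-- `max {1 + C₂, C₃ D}`. -/
def constA (C₁ C₂ C₃ : ℝ) : ℝ := max (1 + C₂) (C₃ * g.constD C₁ C₂)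

/-- `B = max {1, (1 - ζ) C₃ ∑_{j < k₀} (2 (1 - ζ) A)^j}`, where `A = max {1 + C₂, C₃ D}`. -/
def constB (C₁ C₂ C₃ : ℝ) (k₀ : ℕ) : ℝ :=
  max 1 ((1 - g.ζ) * C₃ * ∑ j ∈ Finset.range k₀, (2 * (1 - g.ζ) * g.constA C₁ C₂ C₃) ^ j)

/-- The order of the number of synchronous TQ-learning updates per iteration, for the accuracy
`η` (this is `ε̄`), the confidence `δ` and `k₀` iterations. -/
def sampleBound (C₁ C₂ C₃ w η δ : ℝ) (k₀ : ℕ) : ℝ :=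
  (g.Vmax ^ 2 * g.constB C₁ C₂ C₃ k₀ ^ 2 *
      Real.log (2 * k₀ * (Fintype.card S * Fintype.card A) * g.Vmax * g.constB C₁ C₂ C₃ k₀ /
        (δ * g.β * η)) / (g.β ^ 2 * η ^ 2)) ^ (1 / w) +
    (1 / g.β * Real.log (g.Vmax * g.constB C₁ C₂ C₃ k₀ / η)) ^ (1 / (1 - w))

end Game

end TMFG

end

/-! Convergence of modified T-BR is a monotonicity argument. A trembling-hand strategy puts a fixed
floor on every action and distributes the remaining mass freely, so `G Q s` is the maximum of the
mean of `Q s` over such strategies (`expect_le_G`). Hence the Bellman operator built on `G` is a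
γ-contraction, its fixed point is `optQ`, and trembling around the greedy action of `optQ` is
optimal. Value iteration from 0 preserves monotonicity, supermodularity and increasing differences,
so `optQ` has all three. The largest maximizer then rises with the state and the mean field, and
T-BR started at the bottom increases in stochastic dominance. Such a sequence converges because the
masses of upper sets are monotone and bounded. Lipschitz continuity of the best-response update
makes the limit stationary.

For the learning bound, `Q_t - Q*` is split into averaged sampling errors and a remainder. The
averaged errors form a linear recursion driven by centred, bounded noise, so they are sub-Gaussian
with a variance proxy of order `t ^ (-w)` (`noisyLaw_tail_le`). The remainder involves no fresh
noise: while the averaged errors stay below `b`, it contracts towards `γ b / (1 - γ)`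
(`noisyLaw_window_le`). Half of the `I` updates let the noise settle, and the other half form the
window of contraction, with a union bound over its times. The resulting per-iteration error `η / B`
is amplified by at most `B` along `k₀` mean-field updates (`onlineLaw_error_le`), and failure
probabilities `δ / k₀` add up to at most `δ`. The triangle inequality through modified T-BR gives `2
η`. -/

noncomputable section

namespace TMFG

/-! ### Expectations and the ℓ¹ distance on finite probability spaces. -/

section Expect

variable {X : Type*} [Fintype X]

theorem expect_mono (p : stdSimplex ℝ X) {f h : X → ℝ} (hfh : ∀ x, f x ≤ h x) :
    expect p f ≤ expect p h :=
  Finset.sum_le_sum fun x _ => mul_le_mul_of_nonneg_left (hfh x) (stdSimplex.zero_le p x)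

theorem expect_const (p : stdSimplex ℝ X) (c : ℝ) : expect p (fun _ => c) = c := by
  simp [expect, ← Finset.sum_mul]

theorem expect_add (p : stdSimplex ℝ X) (f h : X → ℝ) :
    expect p (fun x => f x + h x) = expect p f + expect p h := by
  simp [expect, mul_add, Finset.sum_add_distrib]

theorem expect_sub (p : stdSimplex ℝ X) (f h : X → ℝ) :
    expect p (fun x => f x - h x) = expect p f - expect p h := by
  simp [expect, mul_sub, Finset.sum_sub_distrib]

theorem expect_const_mul (p : stdSimplex ℝ X) (c : ℝ) (f : X → ℝ) :
    expect p (fun x => c * f x) = c * expect p f := by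
  simp only [expect, Finset.mul_sum]
  exact Finset.sum_congr rfl fun x _ => by ring

theorem expect_le_of_le (p : stdSimplex ℝ X) {f : X → ℝ} {c : ℝ} (h : ∀ x, f x ≤ c) :
    expect p f ≤ c := (expect_mono p h).trans_eq (expect_const p c)

theorem le_expect_of_le (p : stdSimplex ℝ X) {f : X → ℝ} {c : ℝ} (h : ∀ x, c ≤ f x) :
    c ≤ expect p f := (expect_const p c).symm.le.trans (expect_mono p h)

theorem abs_expect_le (p : stdSimplex ℝ X) {f : X → ℝ} {c : ℝ} (h : ∀ x, |f x| ≤ c) :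
    |expect p f| ≤ c :=
  abs_le.2 ⟨le_expect_of_le p fun x => (abs_le.1 (h x)).1,
    expect_le_of_le p fun x => (abs_le.1 (h x)).2⟩

theorem abs_expect_sub_expect_le (p : stdSimplex ℝ X) {f h : X → ℝ} {c : ℝ}
    (hfh : ∀ x, |f x - h x| ≤ c) : |expect p f - expect p h| ≤ c := by
  rw [← expect_sub]
  exact abs_expect_le p hfh

theorem l1Dist_nonneg (p q : stdSimplex ℝ X) : 0 ≤ l1Dist p q :=
  Finset.sum_nonneg fun _ _ => abs_nonneg _

theorem l1Dist_self (p : stdSimplex ℝ X) : l1Dist p p = 0 := by simp [l1Dist]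

theorem l1Dist_triangle (p q r : stdSimplex ℝ X) : l1Dist p r ≤ l1Dist p q + l1Dist q r := by
  unfold l1Dist
  rw [← Finset.sum_add_distrib]
  exact Finset.sum_le_sum fun x _ => abs_sub_le _ _ _

theorem abs_expect_sub_le_l1Dist (p q : stdSimplex ℝ X) {f : X → ℝ} {c : ℝ}
    (h : ∀ x, |f x| ≤ c) : |expect p f - expect q f| ≤ l1Dist p q * c := by
  unfold expect l1Dist
  rw [← Finset.sum_sub_distrib, Finset.sum_mul]
  refine (Finset.abs_sum_le_sum_abs _ _).trans (Finset.sum_le_sum fun x _ => ?_)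
  rw [← sub_mul, abs_mul]
  exact mul_le_mul_of_nonneg_left (h x) (abs_nonneg _)

end Expect

/-- In a nonempty finite type, a function satisfying `f x ≤ γ c` whenever `c` is an upper bound
of `f`, with `γ < 1`, is nonpositive. -/
theorem nonpos_of_contracting_upper_bound {X : Type*} [Finite X] {γ : ℝ} (hγ : γ < 1)
    (f : X → ℝ) (h : ∀ c, (∀ x, f x ≤ c) → ∀ x, f x ≤ γ * c) (x : X) : f x ≤ 0 := by
  have : Nonempty X := ⟨x⟩
  obtain ⟨m, hm⟩ := Finite.exists_max f
  have := h (f m) hm m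
  have : f m ≤ 0 := by nlinarith
  exact (hm x).trans this

theorem abs_apply_apply_le_norm {S A : Type*} [Fintype S] [Fintype A] (Q : S → A → ℝ) (s : S)
    (a : A) : |Q s a| ≤ ‖Q‖ :=
  (norm_le_pi_norm (Q s) a).trans (norm_le_pi_norm Q s)

theorem norm_le_of_forall_abs_le {S A : Type*} [Fintype S] [Fintype A] {Q : S → A → ℝ} {c : ℝ}
    (hc : 0 ≤ c) (h : ∀ s a, |Q s a| ≤ c) : ‖Q‖ ≤ c :=
  (pi_norm_le_iff_of_nonneg hc).2 fun s => (pi_norm_le_iff_of_nonneg hc).2 fun a => h s a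

theorem le_greedy_value {S A : Type*} [Fintype A] [LinearOrder A] [Nonempty A] (Q : S → A → ℝ)
    (s : S) (a : A) : Q s a ≤ Q s (greedy Q s) := by
  have h := Finset.max'_mem _ (argmaxSet_nonempty Q s)
  simp only [argmaxSet, Finset.mem_filter] at h
  exact h.2 a

theorem le_greedy_of_maximizer {S A : Type*} [Fintype A] [LinearOrder A] [Nonempty A]
    (Q : S → A → ℝ) (s : S) (a : A) (h : ∀ b, Q s b ≤ Q s a) : a ≤ greedy Q s :=
  Finset.le_max' _ _ (by simpa [argmaxSet] using h)

namespace Game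

/-! ### Dynamic programming over trembling-hand strategies. -/

section Value

variable {S A : Type*} [Fintype S] [Fintype A] (g : Game S A)

theorem one_sub_γ_pos : 0 < 1 - g.γ := sub_pos.2 g.γ_lt_one

theorem Vmax_pos : 0 < g.Vmax := one_div_pos.2 g.one_sub_γ_pos

theorem one_add_γ_mul_Vmax : 1 + g.γ * g.Vmax = g.Vmax := by
  have := g.one_sub_γ_pos.ne'
  unfold Vmax
  field_simp
  ring

theorem one_le_Vmax : 1 ≤ g.Vmax := by
  rw [← g.one_add_γ_mul_Vmax]
  linarith [mul_nonneg g.γ_nonneg g.Vmax_pos.le]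

theorem rewardAt_zero (z : MeanField S) (μ : Strategy S A) (s : S) :
    g.rewardAt z μ 0 s = expect (μ s) fun a => g.reward s a z := by
  rw [rewardAt]
  rfl

theorem rewardAt_succ (z : MeanField S) (μ : Strategy S A) (t : ℕ) (s : S) :
    g.rewardAt z μ (t + 1) s =
      expect (μ s) fun a => expect (g.trans s a z) (g.rewardAt z μ t) := by
  rw [rewardAt]
  rfl

theorem abs_rewardAt_le (z : MeanField S) (μ : Strategy S A) (t : ℕ) (s : S) :
    |g.rewardAt z μ t s| ≤ 1 := by
  induction t generalizing s with
  | zero =>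
    rw [rewardAt_zero]
    exact abs_expect_le _ fun a => g.abs_reward_le s a z
  | succ t ih =>
    rw [rewardAt_succ]
    exact abs_expect_le _ fun a => abs_expect_le _ ih

theorem summable_discounted_rewardAt (z : MeanField S) (μ : Strategy S A) (s : S) :
    Summable fun t : ℕ => g.γ ^ t * g.rewardAt z μ t s := by
  refine Summable.of_norm_bounded (summable_geometric_of_lt_one g.γ_nonneg g.γ_lt_one) fun t => ?_
  rw [Real.norm_eq_abs, abs_mul, abs_of_nonneg (pow_nonneg g.γ_nonneg t)]
  exact mul_le_of_le_one_right (pow_nonneg g.γ_nonneg t) (g.abs_rewardAt_le z μ t s)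

/-- The Bellman equation of a stationary strategy. -/
theorem value_eq (z : MeanField S) (μ : Strategy S A) (s : S) :
    g.value z μ s =
      expect (μ s) fun a => g.reward s a z + g.γ * expect (g.trans s a z) (g.value z μ) := by
  have hV : ∀ s, HasSum (fun t : ℕ => g.γ ^ t * g.rewardAt z μ t s) (g.value z μ s) :=
    fun s => (g.summable_discounted_rewardAt z μ s).hasSum
  have h1 : HasSum (fun t : ℕ => g.γ ^ (t + 1) * g.rewardAt z μ (t + 1) s)
      (g.γ * expect (μ s) fun a => expect (g.trans s a z) (g.value z μ)) := by
    have h2 : HasSum (fun t : ℕ => ∑ a, μ s a * ∑ s', g.trans s a z s' *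
        (g.γ ^ t * g.rewardAt z μ t s'))
        (expect (μ s) fun a => expect (g.trans s a z) (g.value z μ)) :=
      hasSum_sum fun a _ => (hasSum_sum fun s' _ => (hV s').mul_left _).mul_left _
    refine (h2.mul_left g.γ).congr_fun fun t => ?_
    rw [rewardAt_succ, pow_succ]
    simp only [expect, Finset.mul_sum]
    exact Finset.sum_congr rfl fun a _ => Finset.sum_congr rfl fun s' _ => by ring
  have h3 := (hasSum_nat_add_iff (f := fun t : ℕ => g.γ ^ t * g.rewardAt z μ t s) 1).1 h1
  rw [(hV s).unique h3, expect_add, expect_const_mul]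
  simp [rewardAt_zero, add_comm]

theorem tremble_level_nonneg [Nontrivial A] : 0 ≤ g.ε / ((Fintype.card A : ℝ) - 1) := by
  have hc : (1 : ℝ) < Fintype.card A := by exact_mod_cast Fintype.one_lt_card
  exact (div_pos g.ε_pos (by linarith)).le

theorem card_mul_tremble_level [Nontrivial A] :
    (Fintype.card A : ℝ) * (g.ε / ((Fintype.card A : ℝ) - 1)) =
      g.ε + g.ε / ((Fintype.card A : ℝ) - 1) := by
  have hc : (1 : ℝ) < Fintype.card A := by exact_mod_cast Fintype.one_lt_card
  have : (Fintype.card A : ℝ) - 1 ≠ 0 := by linarith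
  field_simp
  ring

variable [LinearOrder A] [Nontrivial A]

theorem tremble_apply (Q : S → A → ℝ) (s : S) (a : A) :
    g.tremble Q s a = if a = greedy Q s then 1 - g.ε else g.ε / ((Fintype.card A : ℝ) - 1) := rfl

theorem tremble_mem_trembling (Q : S → A → ℝ) : g.tremble Q ∈ g.trembling := by
  intro s a
  rw [tremble_apply]
  split_ifs
  · exact g.ε_small.le
  · exact le_rfl

/-- Floor plus excess: both coefficients are nonnegative, the second by `ε_small`, so inequalities
can be checked separately on the sum over actions and at the greedy action. -/
theorem expect_tremble (Q : S → A → ℝ) (s : S) (f : A → ℝ) :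
    expect (g.tremble Q s) f = g.ε / ((Fintype.card A : ℝ) - 1) * ∑ a, f a +
      (1 - g.ε - g.ε / ((Fintype.card A : ℝ) - 1)) * f (greedy Q s) := by
  have h : ∀ a, g.tremble Q s a * f a = g.ε / ((Fintype.card A : ℝ) - 1) * f a +
      if a = greedy Q s then (1 - g.ε - g.ε / ((Fintype.card A : ℝ) - 1)) * f a else 0 := by
    intro a
    rw [tremble_apply]
    split_ifs <;> ring
  unfold expect
  rw [Finset.sum_congr rfl fun a _ => h a, Finset.sum_add_distrib, ← Finset.mul_sum,
    Finset.sum_ite_eq' Finset.univ]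
  simp

theorem G_eq_expect (Q : S → A → ℝ) (s : S) : g.G Q s = expect (g.tremble Q s) (Q s) := rfl

/-- Every trembling-hand strategy carries the same floor, hence the same total excess mass, and
`tremble Q` places all of that excess on a maximizer. -/
theorem expect_le_G {ν : Strategy S A} (hν : ν ∈ g.trembling) (Q : S → A → ℝ) (s : S) :
    expect (ν s) (Q s) ≤ g.G Q s := by
  rw [G_eq_expect, expect_tremble]
  set e := g.ε / ((Fintype.card A : ℝ) - 1) with he
  have h1 : expect (ν s) (Q s) = e * ∑ a, Q s a + ∑ a, (ν s a - e) * Q s a := by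
    unfold expect
    rw [Finset.mul_sum, ← Finset.sum_add_distrib]
    exact Finset.sum_congr rfl fun a _ => by ring
  have h2 : ∑ a, (ν s a - e) * Q s a ≤ ∑ a, (ν s a - e) * Q s (greedy Q s) :=
    Finset.sum_le_sum fun a _ =>
      mul_le_mul_of_nonneg_left (le_greedy_value Q s a) (sub_nonneg.2 (hν s a))
  have h3 : ∑ a, (ν s a - e) = 1 - g.ε - e := by
    rw [Finset.sum_sub_distrib, stdSimplex.sum_eq_one, Finset.sum_const, Finset.card_univ,
      nsmul_eq_mul, he, card_mul_tremble_level]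
    ring
  rw [← Finset.sum_mul, h3] at h2
  linarith

/-- A maximum of means is nonexpansive: the strategy optimal for `Q` is also a candidate for `Q'`.
-/
theorem G_sub_le {Q Q' : S → A → ℝ} {s : S} {c : ℝ} (h : ∀ a, Q s a - Q' s a ≤ c) :
    g.G Q s - g.G Q' s ≤ c := by
  have h1 := g.expect_le_G (g.tremble_mem_trembling Q) Q' s
  have h2 : expect (g.tremble Q s) (Q s) - expect (g.tremble Q s) (Q' s) ≤ c := by
    rw [← expect_sub]
    exact expect_le_of_le _ h
  rw [G_eq_expect g Q]
  linarith

theorem abs_G_sub_le {Q Q' : S → A → ℝ} {c : ℝ} (h : ∀ s a, |Q s a - Q' s a| ≤ c) (s : S) :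
    |g.G Q s - g.G Q' s| ≤ c := by
  refine abs_sub_le_iff.2 ⟨g.G_sub_le fun a => (abs_sub_le_iff.1 (h s a)).1,
    g.G_sub_le fun a => (abs_sub_le_iff.1 (h s a)).2⟩

theorem abs_G_le {Q : S → A → ℝ} {c : ℝ} (h : ∀ s a, |Q s a| ≤ c) (s : S) : |g.G Q s| ≤ c :=
  abs_expect_le _ (h s)

/-- The Bellman operator of trembling-hand control on state-action value functions. -/
def bellman (z : MeanField S) (Q : S → A → ℝ) : S → A → ℝ := fun s a =>
  g.reward s a z + g.γ * expect (g.trans s a z) (g.G Q)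

theorem contracting_bellman (z : MeanField S) :
    ContractingWith ⟨g.γ, g.γ_nonneg⟩ (g.bellman z) := by
  refine ⟨by exact_mod_cast g.γ_lt_one, LipschitzWith.of_dist_le_mul fun Q Q' => ?_⟩
  rw [dist_eq_norm, dist_eq_norm]
  refine norm_le_of_forall_abs_le (mul_nonneg g.γ_nonneg (norm_nonneg _)) fun s a => ?_
  have h : |expect (g.trans s a z) (g.G Q) - expect (g.trans s a z) (g.G Q')| ≤ ‖Q - Q'‖ :=
    abs_expect_sub_expect_le _ (g.abs_G_sub_le fun s a => abs_apply_apply_le_norm (Q - Q') s a)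
  have h2 : (g.bellman z Q - g.bellman z Q') s a =
      g.γ * (expect (g.trans s a z) (g.G Q) - expect (g.trans s a z) (g.G Q')) := by
    simp only [bellman, Pi.sub_apply]
    ring
  rw [h2, abs_mul, abs_of_nonneg g.γ_nonneg]
  exact mul_le_mul_of_nonneg_left h g.γ_nonneg

/-- Verification argument: comparing the two Bellman equations, an upper bound `c` for the gap
improves to `γ c`, so the gap cannot be positive. The reverse inequality for `tremble Q` follows in
the same way. -/
theorem value_le_G_of_isFixedPt {z : MeanField S} {Q : S → A → ℝ} (hQ : g.bellman z Q = Q)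
    {ν : Strategy S A} (hν : ν ∈ g.trembling) (s : S) : g.value z ν s ≤ g.G Q s := by
  refine sub_nonpos.1 (nonpos_of_contracting_upper_bound g.γ_lt_one
    (fun s => g.value z ν s - g.G Q s) (fun c hc s => ?_) s)
  have h1 : g.value z ν s ≤ expect (ν s) (Q s) + g.γ * c := by
    rw [value_eq, ← expect_const (ν s) (g.γ * c), ← expect_add]
    refine expect_mono _ fun a => ?_
    have h2 : expect (g.trans s a z) (g.value z ν) ≤ expect (g.trans s a z) (g.G Q) + c := by
      rw [← expect_const (g.trans s a z) c, ← expect_add]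
      exact expect_mono _ fun s' => by linarith [hc s', expect_const (g.trans s a z) c]
    have h3 : Q s a = g.reward s a z + g.γ * expect (g.trans s a z) (g.G Q) :=
      (congrFun (congrFun hQ s) a).symm
    have := mul_le_mul_of_nonneg_left h2 g.γ_nonneg
    linarith
  have h4 := g.expect_le_G hν Q s
  show g.value z ν s - g.G Q s ≤ g.γ * c
  linarith

theorem G_le_value_of_isFixedPt {z : MeanField S} {Q : S → A → ℝ} (hQ : g.bellman z Q = Q)
    (s : S) : g.G Q s ≤ g.value z (g.tremble Q) s := by
  refine sub_nonpos.1 (nonpos_of_contracting_upper_bound g.γ_lt_one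
    (fun s => g.G Q s - g.value z (g.tremble Q) s) (fun c hc s => ?_) s)
  show g.G Q s - g.value z (g.tremble Q) s ≤ g.γ * c
  rw [value_eq, G_eq_expect, ← expect_sub]
  refine expect_le_of_le _ fun a => ?_
  have h2 : expect (g.trans s a z) (g.G Q) - expect (g.trans s a z) (g.value z (g.tremble Q)) ≤ c := by
    rw [← expect_sub]
    exact expect_le_of_le _ hc
  have h3 : Q s a = g.reward s a z + g.γ * expect (g.trans s a z) (g.G Q) :=
    (congrFun (congrFun hQ s) a).symm
  have := mul_le_mul_of_nonneg_left h2 g.γ_nonneg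
  linarith

theorem optValue_eq_of_isFixedPt {z : MeanField S} {Q : S → A → ℝ} (hQ : g.bellman z Q = Q) :
    g.optValue z = g.G Q := by
  funext s
  have : Nonempty g.trembling := ⟨⟨_, g.tremble_mem_trembling Q⟩⟩
  refine le_antisymm (ciSup_le fun ν => g.value_le_G_of_isFixedPt hQ ν.2 s) ?_
  refine (g.G_le_value_of_isFixedPt hQ s).trans
    (le_ciSup (f := fun μ : g.trembling => g.value z μ s) ?_ ⟨_, g.tremble_mem_trembling Q⟩)
  exact ⟨g.G Q s, by rintro _ ⟨ν, rfl⟩; exact g.value_le_G_of_isFixedPt hQ ν.2 s⟩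

theorem optQ_eq_fixedPoint (z : MeanField S) :
    g.optQ z = ContractingWith.fixedPoint (g.bellman z) (g.contracting_bellman z) := by
  have h : g.bellman z _ = _ := (g.contracting_bellman z).fixedPoint_isFixedPt
  conv_rhs => rw [← h]
  unfold optQ
  rw [g.optValue_eq_of_isFixedPt h]
  rfl

theorem bellman_optQ (z : MeanField S) : g.bellman z (g.optQ z) = g.optQ z := by
  rw [optQ_eq_fixedPoint]
  exact (g.contracting_bellman z).fixedPoint_isFixedPt

theorem tendsto_iterate_bellman (z : MeanField S) :
    Filter.Tendsto (fun n => (g.bellman z)^[n] 0) Filter.atTop (nhds (g.optQ z)) := by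
  rw [optQ_eq_fixedPoint]
  exact (g.contracting_bellman z).tendsto_iterate_fixedPoint 0

theorem optQ_apply (z : MeanField S) (s : S) (a : A) :
    g.optQ z s a = g.reward s a z + g.γ * expect (g.trans s a z) (g.G (g.optQ z)) :=
  (congrFun (congrFun (g.bellman_optQ z) s) a).symm

theorem value_le_value_bestResponse (z : MeanField S) {ν : Strategy S A} (hν : ν ∈ g.trembling)
    (s : S) : g.value z ν s ≤ g.value z (g.bestResponse z) s :=
  (g.value_le_G_of_isFixedPt (g.bellman_optQ z) hν s).trans
    (g.G_le_value_of_isFixedPt (g.bellman_optQ z) s)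

theorem abs_optQ_le (z : MeanField S) (s : S) (a : A) : |g.optQ z s a| ≤ g.Vmax := by
  have h : ‖g.optQ z‖ ≤ 1 + g.γ * ‖g.optQ z‖ := by
    refine norm_le_of_forall_abs_le
      (add_nonneg zero_le_one (mul_nonneg g.γ_nonneg (norm_nonneg _))) fun s a => ?_
    rw [optQ_apply]
    refine (abs_add_le _ _).trans (add_le_add (g.abs_reward_le s a z) ?_)
    rw [abs_mul, abs_of_nonneg g.γ_nonneg]
    exact mul_le_mul_of_nonneg_left
      (abs_expect_le _ (g.abs_G_le (abs_apply_apply_le_norm _))) g.γ_nonneg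
  refine (abs_apply_apply_le_norm _ s a).trans ?_
  rw [Vmax, le_div_iff₀ g.one_sub_γ_pos]
  linarith

theorem norm_optQ_sub_le {C₁ C₂ C₃ : ℝ} (hL : g.LipschitzAssumption C₁ C₂ C₃)
    (z z' : MeanField S) : ‖g.optQ z - g.optQ z'‖ ≤ g.constD C₁ C₂ * l1Dist z z' := by
  set d := l1Dist z z' with hd
  have hd0 : 0 ≤ d := l1Dist_nonneg _ _
  have hV := g.Vmax_pos.le
  -- The norm is bounded by itself times `γ` plus a term from the change of reward and kernel;
  -- solving for it produces `constD`. The kernel difference is tested against a function bounded by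
  -- `Vmax`.
  have h : ‖g.optQ z - g.optQ z'‖ ≤
      C₁ * d + g.γ * (C₂ * d * g.Vmax + ‖g.optQ z - g.optQ z'‖) := by
    have hC₁ := hL.C₁_nonneg
    have hC₂ := hL.C₂_nonneg
    have hγ := g.γ_nonneg
    refine norm_le_of_forall_abs_le (by positivity) fun s a => ?_
    have h1 := abs_expect_sub_le_l1Dist (g.trans s a z) (g.trans s a z')
      (g.abs_G_le (g.abs_optQ_le z))
    have h2 := mul_le_mul_of_nonneg_right (hL.trans_lip s a z z') hV
    have h3 : |expect (g.trans s a z') (g.G (g.optQ z)) -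
        expect (g.trans s a z') (g.G (g.optQ z'))| ≤ ‖g.optQ z - g.optQ z'‖ :=
      abs_expect_sub_expect_le _
        (g.abs_G_sub_le fun s a => abs_apply_apply_le_norm (g.optQ z - g.optQ z') s a)
    have h4 := hL.reward_lip s a z z'
    have h5 := abs_sub_le (expect (g.trans s a z) (g.G (g.optQ z)))
      (expect (g.trans s a z') (g.G (g.optQ z))) (expect (g.trans s a z') (g.G (g.optQ z')))
    have h6 : (g.optQ z - g.optQ z') s a = (g.reward s a z - g.reward s a z') +
        g.γ * (expect (g.trans s a z) (g.G (g.optQ z)) -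
          expect (g.trans s a z') (g.G (g.optQ z'))) := by
      rw [Pi.sub_apply, Pi.sub_apply, optQ_apply, optQ_apply]
      ring
    rw [h6]
    refine (abs_add_le _ _).trans (add_le_add h4 ?_)
    rw [abs_mul, abs_of_nonneg hγ]
    exact mul_le_mul_of_nonneg_left (by linarith) hγ
  have h1 : (1 - g.γ) * (g.constD C₁ C₂ * d) = C₁ * d + g.γ * (C₂ * d * g.Vmax) := by
    have := g.one_sub_γ_pos.ne'
    unfold constD Vmax
    field_simp
  have h2 := g.one_sub_γ_pos
  nlinarith

end Value

/-! ### Stability of the mean-field update. -/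

section Update

variable {S A : Type*} [Fintype S] [Fintype A] (g : Game S A)

theorem Phi_apply (z : MeanField S) (μ : Strategy S A) (s' : S) :
    g.Phi z μ s' = (1 - g.ζ) * ∑ s, z s * g.transUnder z μ s s' + g.ζ * g.regen s' := rfl

theorem transUnder_nonneg (z : MeanField S) (μ : Strategy S A) (s s' : S) :
    0 ≤ g.transUnder z μ s s' :=
  Finset.sum_nonneg fun a _ => mul_nonneg (stdSimplex.zero_le _ a) (stdSimplex.zero_le _ s')

theorem sum_transUnder (z : MeanField S) (μ : Strategy S A) (s : S) :
    ∑ s', g.transUnder z μ s s' = 1 := by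
  unfold transUnder
  rw [Finset.sum_comm]
  simp [← Finset.mul_sum]

theorem expect_Phi (z : MeanField S) (μ : Strategy S A) (f : S → ℝ) :
    expect (g.Phi z μ) f = (1 - g.ζ) *
      (expect z fun s => expect (μ s) fun a => expect (g.trans s a z) f) +
        g.ζ * expect g.regen f := by
  have h : ∀ s', g.Phi z μ s' * f s' = (1 - g.ζ) * (∑ s, ∑ a, z s *
      (μ s a * (g.trans s a z s' * f s'))) + g.ζ * (g.regen s' * f s') := by
    intro s'
    simp only [Phi_apply, transUnder, add_mul, Finset.mul_sum, Finset.sum_mul]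
    refine congrArg₂ _ (Finset.sum_congr rfl fun s _ => Finset.sum_congr rfl fun a _ => by ring)
      (by ring)
  unfold expect
  rw [Finset.sum_congr rfl fun s' _ => h s', Finset.sum_add_distrib, ← Finset.mul_sum,
    ← Finset.mul_sum, Finset.sum_comm]
  simp only [Finset.mul_sum]
  congr 1
  refine Finset.sum_congr rfl fun s _ => ?_
  rw [Finset.sum_comm]

theorem sum_abs_transUnder_sub_le {C₂ : ℝ} {z z' : MeanField S}
    (h : ∀ s a, l1Dist (g.trans s a z) (g.trans s a z') ≤ C₂ * l1Dist z z')
    (μ : Strategy S A) (s : S) :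
    ∑ s', |g.transUnder z μ s s' - g.transUnder z' μ s s'| ≤ C₂ * l1Dist z z' := by
  calc ∑ s', |g.transUnder z μ s s' - g.transUnder z' μ s s'|
      ≤ ∑ s', ∑ a, μ s a * |g.trans s a z s' - g.trans s a z' s'| := by
        refine Finset.sum_le_sum fun s' _ => ?_
        unfold transUnder
        rw [← Finset.sum_sub_distrib]
        refine (Finset.abs_sum_le_sum_abs _ _).trans (Finset.sum_le_sum fun a _ => ?_)
        rw [← mul_sub, abs_mul, abs_of_nonneg (stdSimplex.zero_le _ a)]
    _ = expect (μ s) fun a => l1Dist (g.trans s a z) (g.trans s a z') := by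
        rw [Finset.sum_comm]
        simp [expect, l1Dist, Finset.mul_sum]
    _ ≤ _ := expect_le_of_le _ (h s)

/-- Stability of the McKean–Vlasov update. -/
theorem l1Dist_Phi_le {C₂ κ : ℝ} {z z' : MeanField S} {μ μ' : Strategy S A}
    (h : ∀ s a, l1Dist (g.trans s a z) (g.trans s a z') ≤ C₂ * l1Dist z z')
    (hκ : ∀ s, ∑ s', |g.transUnder z' μ s s' - g.transUnder z' μ' s s'| ≤ κ) :
    l1Dist (g.Phi z μ) (g.Phi z' μ') ≤ (1 - g.ζ) * ((1 + C₂) * l1Dist z z' + κ) := by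
  have hζ : 0 ≤ 1 - g.ζ := sub_nonneg.2 g.ζ_le_one
  -- Three perturbations are made in turn: the population, the kernel, and the strategy, the last
  -- one at `z'`. The regeneration terms cancel.
  have hpt : ∀ s', |g.Phi z μ s' - g.Phi z' μ' s'| ≤ (1 - g.ζ) *
      (∑ s, |z s - z' s| * g.transUnder z μ s s' +
        ∑ s, z' s * (|g.transUnder z μ s s' - g.transUnder z' μ s s'| +
          |g.transUnder z' μ s s' - g.transUnder z' μ' s s'|)) := by
    intro s'
    have h1 : g.Phi z μ s' - g.Phi z' μ' s' = (1 - g.ζ) * ∑ s,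
        ((z s - z' s) * g.transUnder z μ s s' + z' s *
          ((g.transUnder z μ s s' - g.transUnder z' μ s s') +
            (g.transUnder z' μ s s' - g.transUnder z' μ' s s'))) := by
      rw [Phi_apply, Phi_apply, add_sub_add_right_eq_sub, ← mul_sub, ← Finset.sum_sub_distrib]
      exact congrArg _ (Finset.sum_congr rfl fun s _ => by ring)
    rw [h1, abs_mul, abs_of_nonneg hζ, ← Finset.sum_add_distrib]
    refine mul_le_mul_of_nonneg_left ((Finset.abs_sum_le_sum_abs _ _).trans
      (Finset.sum_le_sum fun s _ => (abs_add_le _ _).trans (add_le_add ?_ ?_))) hζ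
    · rw [abs_mul, abs_of_nonneg (g.transUnder_nonneg z μ s s')]
    · rw [abs_mul, abs_of_nonneg (stdSimplex.zero_le z' s)]
      exact mul_le_mul_of_nonneg_left (abs_add_le _ _) (stdSimplex.zero_le z' s)
  refine (Finset.sum_le_sum fun s' _ => hpt s').trans ?_
  rw [← Finset.mul_sum]
  refine mul_le_mul_of_nonneg_left ?_ hζ
  rw [Finset.sum_add_distrib, Finset.sum_comm, Finset.sum_comm (f := fun s' s => z' s * _)]
  simp only [← Finset.mul_sum, sum_transUnder, mul_one]
  have h2 : ∑ s, z' s * (∑ s', (|g.transUnder z μ s s' - g.transUnder z' μ s s'| +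
      |g.transUnder z' μ s s' - g.transUnder z' μ' s s'|)) ≤ C₂ * l1Dist z z' + κ := by
    refine expect_le_of_le z' fun s => ?_
    rw [Finset.sum_add_distrib]
    exact add_le_add (g.sum_abs_transUnder_sub_le h μ s) (hκ s)
  have h3 : ∑ s, |z s - z' s| = l1Dist z z' := rfl
  rw [h3]
  linarith

variable [LinearOrder A] [Nontrivial A]

theorem l1Dist_Phi_bestResponse_le {C₁ C₂ C₃ : ℝ} (hL : g.LipschitzAssumption C₁ C₂ C₃)
    (z z' y y' : MeanField S) :
    l1Dist (g.Phi z (g.bestResponse y)) (g.Phi z' (g.bestResponse y')) ≤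
      (1 - g.ζ) * ((1 + C₂) * l1Dist z z' + C₃ * (g.constD C₁ C₂ * l1Dist y y')) :=
  g.l1Dist_Phi_le (fun s a => hL.trans_lip s a z z') fun s =>
    (hL.strategy_lip z' y (g.optQ y') s).trans
      (mul_le_mul_of_nonneg_left (g.norm_optQ_sub_le hL y y') hL.C₃_nonneg)

end Update

end Game

/-! ### Stochastic dominance and monotone convergence. -/

theorem SDLe.refl {X : Type*} [Fintype X] [Preorder X] (p : stdSimplex ℝ X) : SDLe p p :=
  fun _ _ => le_rfl

theorem SDLe.trans {X : Type*} [Fintype X] [Preorder X] {p q r : stdSimplex ℝ X}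
    (hpq : SDLe p q) (hqr : SDLe q r) : SDLe p r :=
  fun f hf => (hpq f hf).trans (hqr f hf)

theorem eq_of_l1Dist_eq_zero {X : Type*} [Fintype X] {p q : stdSimplex ℝ X}
    (h : l1Dist p q = 0) : p = q := by
  refine stdSimplex.ext (funext fun x => ?_)
  have := (Finset.sum_eq_zero_iff_of_nonneg fun x _ => abs_nonneg _).1 h x (Finset.mem_univ x)
  exact sub_eq_zero.1 (abs_eq_zero.1 this)

theorem l1Dist_comm {X : Type*} [Fintype X] (p q : stdSimplex ℝ X) :
    l1Dist p q = l1Dist q p := by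
  simp only [l1Dist, abs_sub_comm]

/-- A sequence of probability vectors that increases in stochastic dominance converges. -/
theorem exists_tendsto_of_SDLe_succ {X : Type*} [Fintype X] [PartialOrder X]
    (z : ℕ → stdSimplex ℝ X) (hz : ∀ k, SDLe (z k) (z (k + 1))) :
    ∃ y : stdSimplex ℝ X,
      Filter.Tendsto (fun k => l1Dist (z k) y) Filter.atTop (nhds 0) := by
  classical
  have hconv : ∀ U : Set X, IsUpperSet U → ∃ l : ℝ,
      Filter.Tendsto (fun k => expect (z k) (fun x => if x ∈ U then 1 else 0))
        Filter.atTop (nhds l) := by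
    intro U hU
    have hmono : Monotone fun x => if x ∈ U then (1 : ℝ) else 0 := by
      intro x y hxy
      by_cases hx : x ∈ U
      · simp [hx, hU hxy hx]
      · simp only [hx, if_false]
        split_ifs <;> norm_num
    refine ⟨_, tendsto_atTop_ciSup (monotone_nat_of_le_succ fun k => hz k _ hmono) ⟨1, ?_⟩⟩
    rintro _ ⟨k, rfl⟩
    exact expect_le_of_le _ fun x => by split_ifs <;> norm_num
  -- The singleton of `x` is the difference of the upper sets `Set.Ici x` and `Set.Ioi x`.
  have hpt : ∀ x, ∃ l : ℝ, Filter.Tendsto (fun k => z k x) Filter.atTop (nhds l) := by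
    intro x
    obtain ⟨l₁, h₁⟩ := hconv (Set.Ici x) (isUpperSet_Ici x)
    obtain ⟨l₂, h₂⟩ := hconv (Set.Ioi x) (isUpperSet_Ioi x)
    refine ⟨l₁ - l₂, (h₁.sub h₂).congr fun k => ?_⟩
    rw [← expect_sub]
    unfold expect
    rw [Finset.sum_eq_single x]
    · simp
    · intro y _ hy
      have : y ∈ Set.Ici x ↔ y ∈ Set.Ioi x :=
        ⟨fun h => lt_of_le_of_ne h (Ne.symm hy), fun h => le_of_lt h⟩
      simp [this]
    · simp
  choose l hl using hpt
  have hlim : Filter.Tendsto (fun k => (z k : X → ℝ)) Filter.atTop (nhds l) := tendsto_pi_nhds.2 hl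
  have hmem : l ∈ stdSimplex ℝ X :=
    (isClosed_stdSimplex ℝ X).mem_of_tendsto hlim (Filter.Eventually.of_forall fun k => (z k).2)
  refine ⟨⟨l, hmem⟩, ?_⟩
  change Filter.Tendsto (fun k => ∑ x, |z k x - l x|) Filter.atTop (nhds 0)
  have h0 : ∀ x, Filter.Tendsto (fun k => |z k x - l x|) Filter.atTop (nhds 0) := by
    intro x
    have := ((hl x).sub_const (l x)).abs
    simpa using this
  simpa using tendsto_finsetSum Finset.univ fun x _ => h0 x

/-! ### Monotone comparative statics of the greedy action. -/

section Greedy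

variable {S A : Type*} [Fintype A] [LinearOrder A]

/-- Topkis' argument. If the inequality failed, moving up from `greedy Q' s'` to `greedy Q s` would
not lose under `Q`, hence not under `Q'`. The larger action would then also maximize `Q'`, against
the choice of the largest maximizer. -/
theorem greedy_le_greedy [Nonempty A] {Q Q' : S → A → ℝ} {s s' : S}
    (h : ∀ a b, a ≤ b → Q s b - Q s a ≤ Q' s' b - Q' s' a) : greedy Q s ≤ greedy Q' s' := by
  by_contra! hlt
  have h1 := h _ _ hlt.le
  have h2 := le_greedy_value Q s (greedy Q' s')
  refine hlt.not_ge (le_greedy_of_maximizer Q' s' _ fun b => ?_)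
  have := le_greedy_value Q' s' b
  linarith

theorem Game.tremble_SDLe [Fintype S] [Nontrivial A] (g : Game S A) {Q Q' : S → A → ℝ} {s s' : S}
    (h : ∀ a b, a ≤ b → Q s b - Q s a ≤ Q' s' b - Q' s' a) :
    SDLe (g.tremble Q s) (g.tremble Q' s') := by
  intro f hf
  rw [Game.expect_tremble, Game.expect_tremble]
  have h1 := hf (greedy_le_greedy h)
  have h2 : 0 ≤ 1 - g.ε - g.ε / ((Fintype.card A : ℝ) - 1) := by linarith [g.ε_small]
  have := mul_le_mul_of_nonneg_left h1 h2
  linarith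

end Greedy

/-- A family of state-action value functions, indexed by mean fields, with strategic
complementarities. -/
structure IsComplementary {S A : Type*} [Fintype S] [Lattice S] [Lattice A]
    (Q : MeanField S → S → A → ℝ) : Prop where
  mono : ∀ z a, Monotone fun s => Q z s a
  supermodular : ∀ z (x y : S × A),
    Q z x.1 x.2 + Q z y.1 y.2 ≤ Q z (x ⊔ y).1 (x ⊔ y).2 + Q z (x ⊓ y).1 (x ⊓ y).2
  incDiff : ∀ z z', SDLe z z' → ∀ x y : S × A, x ≤ y →
    Q z y.1 y.2 - Q z x.1 x.2 ≤ Q z' y.1 y.2 - Q z' x.1 x.2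

/-! ### Preservation of complementarities by the Bellman operator. -/

namespace IsComplementary

variable {S A : Type*} [Fintype S] [Lattice S] [LinearOrder A]
  {Q : MeanField S → S → A → ℝ}

theorem sub_le_sub_of_le (hQ : IsComplementary Q) (z : MeanField S) {s s' : S} (hs : s ≤ s')
    {a b : A} (hab : a ≤ b) : Q z s b - Q z s a ≤ Q z s' b - Q z s' a := by
  have := hQ.supermodular z (s', a) (s, b)
  simp only [Prod.mk_sup_mk, Prod.mk_inf_mk, sup_eq_left.2 hs, sup_eq_right.2 hab,
    inf_eq_right.2 hs, inf_eq_left.2 hab] at this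
  linarith

theorem sub_le_sub_of_SDLe (hQ : IsComplementary Q) {z z' : MeanField S} (hz : SDLe z z')
    {s s' : S} (hs : s ≤ s') {a b : A} (hab : a ≤ b) :
    Q z s b - Q z s a ≤ Q z' s' b - Q z' s' a :=
  (hQ.incDiff z z' hz (s, a) (s, b) ⟨le_rfl, hab⟩).trans (hQ.sub_le_sub_of_le z' hs hab)

variable [Fintype A]

/-- The maximal value inherits increasing differences in the state and the mean field. -/
theorem greedy_value_incDiff [Nonempty A] (hQ : IsComplementary Q) {z z' : MeanField S}
    (hz : SDLe z z') {s s' : S} (hs : s ≤ s') :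
    Q z s' (greedy (Q z) s') - Q z s (greedy (Q z) s) ≤
      Q z' s' (greedy (Q z') s') - Q z' s (greedy (Q z') s) := by
  -- The two remaining maxima are bounded below by values at `a` or `b`. If `a ≤ b`, increasing
  -- differences from `(s, a)` to `(s', b)` suffice; otherwise supermodularity at `z` first
  -- exchanges `b` for `a`.
  set a := greedy (Q z') s
  set b := greedy (Q z) s'
  rcases le_total a b with hab | hab
  · have h1 := hQ.incDiff z z' hz (s, a) (s', b) ⟨hs, hab⟩
    have h2 := le_greedy_value (Q z) s a
    have h3 := le_greedy_value (Q z') s' b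
    dsimp only at h1
    linarith
  · have h1 := hQ.incDiff z z' hz (s, a) (s', a) ⟨hs, le_rfl⟩
    have h2 := hQ.sub_le_sub_of_le z hs hab
    have h3 := le_greedy_value (Q z) s b
    have h4 := le_greedy_value (Q z') s' a
    dsimp only at h1
    linarith

variable [Nontrivial A] (g : Game S A)

/-- Repeating at `s'` the mixed action chosen at `s` already does no worse. -/
theorem monotone_G (hQ : IsComplementary Q) (z : MeanField S) : Monotone (g.G (Q z)) := by
  intro s s' hs
  refine le_trans ?_ (g.expect_le_G (ν := fun _ => g.tremble (Q z) s)
    (fun _ a => g.tremble_mem_trembling (Q z) s a) (Q z) s')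
  exact expect_mono _ fun a => hQ.mono z a hs

theorem G_incDiff (hQ : IsComplementary Q) {z z' : MeanField S} (hz : SDLe z z') :
    Monotone fun s => g.G (Q z') s - g.G (Q z) s := by
  intro s s' hs
  simp only [Game.G_eq_expect, Game.expect_tremble]
  have h1 := hQ.greedy_value_incDiff hz hs
  have h2 : 0 ≤ 1 - g.ε - g.ε / ((Fintype.card A : ℝ) - 1) := by linarith [g.ε_small]
  have h3 := mul_le_mul_of_nonneg_left h1 h2
  have h4 : ∑ a, Q z s' a - ∑ a, Q z s a ≤ ∑ a, Q z' s' a - ∑ a, Q z' s a := by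
    rw [← Finset.sum_sub_distrib, ← Finset.sum_sub_distrib]
    exact Finset.sum_le_sum fun a _ => hQ.incDiff z z' hz (s, a) (s', a) ⟨hs, le_rfl⟩
  have h5 := mul_le_mul_of_nonneg_left h4 g.tremble_level_nonneg
  linarith

theorem bellman (hg : g.StrategicComplementarities) (hQ : IsComplementary Q) :
    IsComplementary fun z => g.bellman z (Q z) where
  mono z a s s' hs := by
    have h := hg.trans_mono z z (SDLe.refl z) (s, a) (s', a) ⟨hs, le_rfl⟩ _ (hQ.monotone_G g z)
    exact add_le_add (hg.reward_mono a z hs) (mul_le_mul_of_nonneg_left h g.γ_nonneg)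
  supermodular z x y := by
    have h1 := hg.reward_supermodular z x y
    have h2 := mul_le_mul_of_nonneg_left
      (hg.trans_supermodular z _ (hQ.monotone_G g z) x y) g.γ_nonneg
    simp only [Game.bellman]
    linarith
  incDiff z z' hz x y hxy := by
    have h1 := hg.reward_incDiff z z' hz x y hxy
    -- The kernel and the integrand both depend on `z`. First the kernel changes with `G (Q z)`
    -- fixed; then the increment `G (Q z') - G (Q z)`, monotone in the state, is tested against the
    -- kernel at `z'`.
    have h2 := hg.trans_incDiff z z' hz _ (hQ.monotone_G g z) x y hxy
    have h3 := hg.trans_mono z' z' (SDLe.refl z') x y hxy _ (hQ.G_incDiff g hz)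
    rw [expect_sub, expect_sub] at h3
    have h4 : expect (g.trans y.1 y.2 z) (g.G (Q z)) - expect (g.trans x.1 x.2 z) (g.G (Q z)) ≤
        expect (g.trans y.1 y.2 z') (g.G (Q z')) - expect (g.trans x.1 x.2 z') (g.G (Q z')) := by
      linarith
    have h5 := mul_le_mul_of_nonneg_left h4 g.γ_nonneg
    simp only [Game.bellman]
    linarith

end IsComplementary

/-! ### Monotonicity and convergence of modified T-BR. -/

namespace Game

variable {S A : Type*} [Fintype S] [Lattice S] [Fintype A] [LinearOrder A] (g : Game S A)

/-- The population is changed first, under `μ`, and then the strategy and the kernel state by state.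
This is why monotonicity in the state is needed of the lower strategy only. -/
theorem Phi_SDLe (hg : g.StrategicComplementarities) {z z' : MeanField S} (hz : SDLe z z')
    {μ μ' : Strategy S A} (hμ : ∀ s s', s ≤ s' → SDLe (μ s) (μ s'))
    (hμμ' : ∀ s, SDLe (μ s) (μ' s)) : SDLe (g.Phi z μ) (g.Phi z' μ') := by
  intro f hf
  have hP : ∀ s z, Monotone fun a => expect (g.trans s a z) f := fun s z a b hab =>
    hg.trans_mono z z (SDLe.refl z) (s, a) (s, b) ⟨le_rfl, hab⟩ f hf
  have hmono : Monotone fun s => expect (μ s) fun a => expect (g.trans s a z) f := by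
    intro s s' hs
    exact (hμ s s' hs _ (hP s z)).trans (expect_mono _ fun a =>
      hg.trans_mono z z (SDLe.refl z) (s, a) (s', a) ⟨hs, le_rfl⟩ f hf)
  rw [expect_Phi, expect_Phi]
  gcongr
  · exact sub_nonneg.2 g.ζ_le_one
  · refine (hz _ hmono).trans (expect_mono _ fun s => ?_)
    exact (hμμ' s _ (hP s z)).trans (expect_mono _ fun a =>
      hg.trans_mono z z' hz (s, a) (s, a) le_rfl f hf)

variable [Nontrivial A]

/-- The defining inequalities hold for the zero function, survive each step of value iteration, and
pass to pointwise limits. -/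
theorem isComplementary_optQ (hg : g.StrategicComplementarities) : IsComplementary g.optQ := by
  have hn : ∀ n : ℕ, IsComplementary fun z => (g.bellman z)^[n] 0 := by
    intro n
    induction n with
    | zero => exact ⟨fun _ _ => monotone_const, by simp, by simp⟩
    | succ n ih =>
      simp only [Function.iterate_succ_apply']
      exact ih.bellman g hg
  have hlim : ∀ z s a, Filter.Tendsto (fun n => (g.bellman z)^[n] 0 s a) Filter.atTop
      (nhds (g.optQ z s a)) := fun z s a =>
    tendsto_pi_nhds.1 (tendsto_pi_nhds.1 (g.tendsto_iterate_bellman z) s) a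
  exact
    { mono := fun z a s s' hs =>
        le_of_tendsto_of_tendsto' (hlim z s a) (hlim z s' a) fun n => (hn n).mono z a hs
      supermodular := fun z x y =>
        le_of_tendsto_of_tendsto' ((hlim z _ _).add (hlim z _ _)) ((hlim z _ _).add (hlim z _ _))
          fun n => (hn n).supermodular z x y
      incDiff := fun z z' hz x y hxy =>
        le_of_tendsto_of_tendsto' ((hlim z _ _).sub (hlim z _ _))
          ((hlim z' _ _).sub (hlim z' _ _)) fun n => (hn n).incDiff z z' hz x y hxy }

theorem bestResponse_SDLe (hg : g.StrategicComplementarities) {z z' : MeanField S}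
    (hz : SDLe z z') {s s' : S} (hs : s ≤ s') :
    SDLe (g.bestResponse z s) (g.bestResponse z' s') :=
  g.tremble_SDLe fun _ _ hab => (g.isComplementary_optQ hg).sub_le_sub_of_SDLe hz hs hab

theorem modTBR_SDLe_succ (hg : g.StrategicComplementarities) {z₀ : MeanField S}
    {μ₀ : Strategy S A} (hz₀ : ∀ z, SDLe z₀ z)
    (hμ₀ : ∀ s s', s ≤ s' → SDLe (μ₀ s) (μ₀ s'))
    (hbr : ∀ s, SDLe (μ₀ s) (g.bestResponse z₀ s)) (k : ℕ) :
    (SDLe (g.modTBR z₀ μ₀ k).1 (g.modTBR z₀ μ₀ (k + 1)).1 ∧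
      ∀ s, SDLe ((g.modTBR z₀ μ₀ k).2 s) ((g.modTBR z₀ μ₀ (k + 1)).2 s)) ∧
    ∀ s s', s ≤ s' → SDLe ((g.modTBR z₀ μ₀ k).2 s) ((g.modTBR z₀ μ₀ k).2 s') := by
  induction k with
  | zero => exact ⟨⟨hz₀ _, fun s => SDLe.refl _⟩, hμ₀⟩
  | succ k ih =>
    obtain ⟨⟨ihz, ihμ⟩, ihs⟩ := ih
    cases k with
    -- Here `μ₀` gives way to the best response to `z₁`; the hypothesis on `μ₀` concerns `z₀`, and
    -- `z₀ ⪯ z₁` bridges the two.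
    | zero =>
      exact ⟨⟨g.Phi_SDLe hg (hz₀ _) hμ₀ fun s => SDLe.refl _,
        fun s => (hbr s).trans (g.bestResponse_SDLe hg (hz₀ _) le_rfl)⟩, hμ₀⟩
    | succ k =>
      exact ⟨⟨g.Phi_SDLe hg ihz ihs ihμ, fun s => g.bestResponse_SDLe hg ihz le_rfl⟩,
        fun s s' hs => g.bestResponse_SDLe hg (SDLe.refl _) hs⟩

/-- Modified T-BR from below converges to a T-MFE. -/
theorem exists_isTMFE_tendsto_modTBR (hg : g.StrategicComplementarities) {C₁ C₂ C₃ : ℝ}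
    (hL : g.LipschitzAssumption C₁ C₂ C₃) {z₀ : MeanField S} {μ₀ : Strategy S A}
    (hz₀ : ∀ z, SDLe z₀ z) (hμ₀ : ∀ s s', s ≤ s' → SDLe (μ₀ s) (μ₀ s'))
    (hbr : ∀ s, SDLe (μ₀ s) (g.bestResponse z₀ s)) :
    ∃ z : MeanField S, g.IsTMFE z (g.bestResponse z) ∧
      Filter.Tendsto (fun k => l1Dist (g.modTBR z₀ μ₀ k).1 z) Filter.atTop (nhds 0) := by
  obtain ⟨z, hz⟩ := exists_tendsto_of_SDLe_succ (fun k => (g.modTBR z₀ μ₀ k).1)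
    fun k => (g.modTBR_SDLe_succ hg hz₀ hμ₀ hbr k).1.1
  refine ⟨z, ⟨⟨g.tremble_mem_trembling _, fun ν hν s => g.value_le_value_bestResponse z hν s⟩,
    eq_of_l1Dist_eq_zero (le_antisymm ?_ (l1Dist_nonneg _ _))⟩, hz⟩
  set d : ℕ → ℝ := fun k => l1Dist (g.modTBR z₀ μ₀ k).1 z with hd
  have hshift : ∀ j, Filter.Tendsto (fun k => d (k + j)) Filter.atTop (nhds 0) := fun j =>
    (Filter.tendsto_add_atTop_iff_nat j).2 hz
  -- Entry 3 has the first mean field produced by a best response: `z₃` is the update of `z₂` under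
  -- the response to `z₁`, whereas `z₂` still uses `μ₀`.
  have hlim : Filter.Tendsto (fun k => d (k + 3) + (1 - g.ζ) *
      ((1 + C₂) * d (k + 2) + C₃ * (g.constD C₁ C₂ * d (k + 1)))) Filter.atTop (nhds 0) := by
    have := (hshift 3).add ((((hshift 2).const_mul (1 + C₂)).add
      (((hshift 1).const_mul (g.constD C₁ C₂)).const_mul C₃)).const_mul (1 - g.ζ))
    simpa using this
  refine ge_of_tendsto' hlim fun k => ?_
  have h1 := l1Dist_triangle z (g.modTBR z₀ μ₀ (k + 3)).1 (g.Phi z (g.bestResponse z))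
  rw [l1Dist_comm z (g.modTBR z₀ μ₀ (k + 3)).1] at h1
  exact h1.trans (add_le_add le_rfl (g.l1Dist_Phi_bestResponse_le hL _ _ _ _))

end Game

/-! ### Discrete Markov chains, Markov's inequality and Hoeffding's lemma. -/

section PMF

variable {α β : Type*}

theorem tsum_bind_mul (p : PMF α) (q : α → PMF β) (f : β → ℝ≥0∞) :
    ∑' b, p.bind q b * f b = ∑' a, p a * ∑' b, q a b * f b := by
  simp only [PMF.bind_apply, ← ENNReal.tsum_mul_right, ← ENNReal.tsum_mul_left]
  rw [ENNReal.tsum_comm]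
  simp only [mul_assoc]

theorem tsum_pure_mul (a : α) (f : α → ℝ≥0∞) : ∑' b, PMF.pure a b * f b = f a := by
  classical
  rw [tsum_eq_single a]
  · simp
  · intro b hb
    simp [PMF.pure_apply, hb]

theorem tsum_map_mul (p : PMF α) (h : α → β) (f : β → ℝ≥0∞) :
    ∑' b, p.map h b * f b = ∑' a, p a * f (h a) := by
  rw [PMF.map, tsum_bind_mul]
  simp only [Function.comp, tsum_pure_mul]

theorem mul_toOuterMeasure_le_tsum (p : PMF α) {s : Set α} {f : α → ℝ≥0∞} {c : ℝ≥0∞}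
    (h : ∀ a ∈ s, c ≤ f a) : c * p.toOuterMeasure s ≤ ∑' a, p a * f a := by
  rw [PMF.toOuterMeasure_apply, ← ENNReal.tsum_mul_left]
  refine ENNReal.tsum_le_tsum fun a => ?_
  by_cases ha : a ∈ s
  · rw [Set.indicator_of_mem ha, mul_comm]
    gcongr
    exact h a ha
  · simp [ha]

/-- Failure probabilities add up along a step of a Markov chain. -/
theorem toOuterMeasure_bind_le (p : PMF α) (q : α → PMF β) {bad : Set α} {s : Set β} {κ : ℝ≥0∞}
    (h : ∀ a ∈ p.support, a ∉ bad → (q a).toOuterMeasure s ≤ κ) :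
    (p.bind q).toOuterMeasure s ≤ p.toOuterMeasure bad + κ := by
  have hle_one : ∀ a, (q a).toOuterMeasure s ≤ 1 := by
    intro a
    rw [PMF.toOuterMeasure_apply, ← (q a).tsum_coe]
    exact ENNReal.tsum_le_tsum fun b => Set.indicator_le_self s _ b
  rw [PMF.toOuterMeasure_bind_apply, PMF.toOuterMeasure_apply]
  calc ∑' a, p a * (q a).toOuterMeasure s
      ≤ ∑' a, (bad.indicator p a + p a * κ) := by
        refine ENNReal.tsum_le_tsum fun a => ?_
        by_cases hp : a ∈ p.support
        · by_cases ha : a ∈ bad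
          · rw [Set.indicator_of_mem ha]
            exact le_add_right (mul_le_of_le_one_right' (hle_one a))
          · exact le_add_left (mul_le_mul_right (h a hp ha) _)
        · rw [PMF.mem_support_iff, not_not] at hp
          simp [hp]
    _ = _ := by rw [ENNReal.tsum_add, ENNReal.tsum_mul_right, p.tsum_coe, one_mul]

theorem toOuterMeasure_eq_zero_of_support (p : PMF α) {s : Set α}
    (h : ∀ a ∈ p.support, a ∉ s) : p.toOuterMeasure s = 0 := by
  rw [PMF.toOuterMeasure_apply_eq_zero_iff]
  exact Set.disjoint_left.2 h

theorem one_sub_le_toOuterMeasure (p : PMF α) {s : Set α} {κ : ℝ≥0∞}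
    (h : p.toOuterMeasure sᶜ ≤ κ) : 1 - κ ≤ p.toOuterMeasure s := by
  have h1 : p.toOuterMeasure Set.univ = 1 :=
    (p.toOuterMeasure_apply_eq_one_iff _).2 (Set.subset_univ _)
  rw [tsub_le_iff_right, ← h1, ← Set.union_compl_self s]
  exact (MeasureTheory.measure_union_le _ _).trans (add_le_add le_rfl h)

end PMF

/-- Hoeffding's lemma for centred functions on a finite probability space. -/
theorem expect_exp_le {X : Type*} [Fintype X] (p : stdSimplex ℝ X) {f : X → ℝ} {c : ℝ}
    (hc : 0 < c) (hf : ∀ x, |f x| ≤ c) (h0 : expect p f = 0) (l : ℝ) :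
    expect p (fun x => Real.exp (l * f x)) ≤ Real.exp (l ^ 2 * c ^ 2 / 2) := by
  -- Convexity puts `exp` below its chord over `[-l c, l c]`; the linear part of the chord has mean
  -- zero.
  have hpt : ∀ x, Real.exp (l * f x) ≤ Real.cosh (l * c) + Real.sinh (l * c) / c * f x := by
    intro x
    obtain ⟨h1, h2⟩ := abs_le.1 (hf x)
    have hp : 0 ≤ (c + f x) / (2 * c) := div_nonneg (by linarith) (by linarith)
    have hq : 0 ≤ (c - f x) / (2 * c) := div_nonneg (by linarith) (by linarith)
    have hpq : (c + f x) / (2 * c) + (c - f x) / (2 * c) = 1 := by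
      field_simp
      ring
    have h := convexOn_exp.2 (Set.mem_univ (l * c)) (Set.mem_univ (-(l * c))) hp hq hpq
    simp only [smul_eq_mul] at h
    have e1 : (c + f x) / (2 * c) * (l * c) + (c - f x) / (2 * c) * -(l * c) = l * f x := by
      field_simp
      ring
    rw [e1] at h
    refine h.trans_eq ?_
    rw [Real.cosh_eq, Real.sinh_eq]
    field_simp
    ring
  calc expect p (fun x => Real.exp (l * f x))
      ≤ expect p fun x => Real.cosh (l * c) + Real.sinh (l * c) / c * f x := expect_mono p hpt
    _ = Real.cosh (l * c) := by rw [expect_add, expect_const, expect_const_mul, h0]; ring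
    _ ≤ Real.exp ((l * c) ^ 2 / 2) := Real.cosh_le_exp_half_sq _
    _ = _ := by rw [mul_pow]

theorem abs_convex_comb_le {α x y c : ℝ} (h0 : 0 ≤ α) (h1 : α ≤ 1) (hx : |x| ≤ c)
    (hy : |y| ≤ c) : |(1 - α) * x + α * y| ≤ c := by
  rw [abs_le] at *
  constructor <;> nlinarith

/-! ### Variance of the averaged noise. -/

section StepSize

/-- The variance proxy of averaged noise under the step sizes `1 / (t + 1) ^ w`. -/
def noiseVar (w : ℝ) : ℕ → ℝ
  | 0 => 0
  | t + 1 => (1 - 1 / ((t : ℝ) + 1) ^ w) ^ 2 * noiseVar w t + (1 / ((t : ℝ) + 1) ^ w) ^ 2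

theorem stepSize_pos (w : ℝ) (t : ℕ) : 0 < 1 / ((t : ℝ) + 1) ^ w := by positivity

theorem stepSize_le_one {w : ℝ} (hw : 0 ≤ w) (t : ℕ) : 1 / ((t : ℝ) + 1) ^ w ≤ 1 := by
  rw [div_le_one (by positivity)]
  exact Real.one_le_rpow (by linarith [t.cast_nonneg (α := ℝ)]) hw

/-- With consecutive step sizes `α'` and `α`, the induction closes once `(1 - α) α' ≤ α`: then `(1 -
α)² α' + α² ≤ (1 - α) α + α² = α`. For `w ≤ 1` the step sizes decay slowly enough for this. -/
theorem noiseVar_succ_le {w : ℝ} (hw : 0 ≤ w) (hw' : w ≤ 1) (t : ℕ) :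
    noiseVar w (t + 1) ≤ 1 / ((t : ℝ) + 1) ^ w := by
  induction t with
  | zero => simp [noiseVar]
  | succ t ih =>
    rw [noiseVar]
    push_cast
    set α := 1 / ((t : ℝ) + 1 + 1) ^ w with hα
    set α' := 1 / ((t : ℝ) + 1) ^ w with hα'
    have ht : (0 : ℝ) ≤ t := t.cast_nonneg
    have hα0 : 0 < α := by positivity
    have hα1 : α ≤ 1 := by simpa [hα] using stepSize_le_one hw (t + 1)
    have hα'0 : 0 < α' := by positivity
    have hratio : 1 - α ≤ α / α' := by
      have e1 : α / α' = (((t : ℝ) + 1) / ((t : ℝ) + 1 + 1)) ^ w := by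
        rw [Real.div_rpow (by positivity) (by positivity), hα, hα']
        field_simp
      have e2 : ((t : ℝ) + 1) / ((t : ℝ) + 1 + 1) ≤ (((t : ℝ) + 1) / ((t : ℝ) + 1 + 1)) ^ w :=
        Real.self_le_rpow_of_le_one (by positivity) (by rw [div_le_one (by positivity)]; linarith)
          hw'
      have e3 : ((t : ℝ) + 1) / ((t : ℝ) + 1 + 1) = 1 - 1 / ((t : ℝ) + 1 + 1) := by
        field_simp
        ring
      have e4 : 1 / ((t : ℝ) + 1 + 1) ≤ α := by
        refine one_div_le_one_div_of_le (by positivity) ?_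
        exact Real.rpow_le_self_of_one_le (by linarith) hw'
      linarith
    have h1 : (1 - α) * α' ≤ α := (le_div_iff₀ hα'0).1 hratio
    have h2 : (1 - α) ^ 2 * noiseVar w (t + 1) ≤ (1 - α) ^ 2 * α' :=
      mul_le_mul_of_nonneg_left ih (sq_nonneg _)
    have h3 : (1 - α) * ((1 - α) * α') ≤ (1 - α) * α :=
      mul_le_mul_of_nonneg_left h1 (by linarith)
    nlinarith

end StepSize

/-! ### Finite-time analysis of synchronous TQ-learning. -/

namespace Game

section Noise

variable {S A : Type*} [Fintype S] [Fintype A] [LinearOrder A] [Nontrivial A] (g : Game S A)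

/-- The centred sampling error of a TQ-learning update at `(s, a)` when `s'` is sampled. -/
def samplingError (z : MeanField S) (Q : S → A → ℝ) (s : S) (a : A) (s' : S) : ℝ :=
  g.γ * (g.G Q s' - expect (g.trans s a z) (g.G Q))

theorem expect_samplingError (z : MeanField S) (Q : S → A → ℝ) (s : S) (a : A) :
    expect (g.trans s a z) (g.samplingError z Q s a) = 0 := by
  unfold samplingError
  rw [expect_const_mul, expect_sub, expect_const, sub_self, mul_zero]

theorem abs_samplingError_le (z : MeanField S) {Q : S → A → ℝ} {c : ℝ}
    (hQ : ∀ s a, |Q s a| ≤ c) (s : S) (a : A) (s' : S) :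
    |g.samplingError z Q s a s'| ≤ 2 * c := by
  unfold samplingError
  have h1 := g.abs_G_le hQ s'
  have h2 := abs_expect_le (g.trans s a z) (g.abs_G_le hQ)
  rw [abs_mul, abs_of_nonneg g.γ_nonneg]
  refine (mul_le_of_le_one_left (abs_nonneg _) g.γ_lt_one.le).trans ((abs_sub _ _).trans ?_)
  linarith

/-- A TQ-learning update together with the averaged sampling errors. -/
def noisyUpdate (z : MeanField S) (α : ℝ) (x : (S → A → ℝ) × (S → A → ℝ)) (σ : S × A → S) :
    (S → A → ℝ) × (S → A → ℝ) :=
  (g.tqUpdate z α x.1 σ,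
    fun s a => (1 - α) * x.2 s a + α * g.samplingError z x.1 s a (σ (s, a)))

/-- One step of the noise-free part of the TQ-learning error. -/
theorem abs_noisyUpdate_sub_le (z : MeanField S) {α u b : ℝ} (h0 : 0 ≤ α) (h1 : α ≤ 1)
    {x : (S → A → ℝ) × (S → A → ℝ)} (hu : ∀ s a, |x.1 s a - g.optQ z s a - x.2 s a| ≤ u)
    (hb : ∀ s a, |x.2 s a| ≤ b) (σ : S × A → S) (s : S) (a : A) :
    |(g.noisyUpdate z α x σ).1 s a - g.optQ z s a - (g.noisyUpdate z α x σ).2 s a| ≤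
      (1 - α) * u + α * (g.γ * (u + b)) := by
  have hd : ∀ s a, |x.1 s a - g.optQ z s a| ≤ u + b := fun s a => by
    have := abs_add_le (x.1 s a - g.optQ z s a - x.2 s a) (x.2 s a)
    rw [sub_add_cancel] at this
    linarith [hu s a, hb s a]
  have h2 : |expect (g.trans s a z) (g.G x.1) - expect (g.trans s a z) (g.G (g.optQ z))| ≤
      u + b := abs_expect_sub_expect_le _ (g.abs_G_sub_le hd)
  -- The sampled next state cancels, leaving the exact Bellman increment.
  have h3 : (g.noisyUpdate z α x σ).1 s a - g.optQ z s a - (g.noisyUpdate z α x σ).2 s a =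
      (1 - α) * (x.1 s a - g.optQ z s a - x.2 s a) + α * (g.γ *
        (expect (g.trans s a z) (g.G x.1) - expect (g.trans s a z) (g.G (g.optQ z)))) := by
    simp only [noisyUpdate, tqUpdate, samplingError]
    linear_combination (-α) * g.optQ_apply z s a
  rw [h3]
  refine (abs_add_le _ _).trans (add_le_add ?_ ?_)
  · rw [abs_mul, abs_of_nonneg (sub_nonneg.2 h1)]
    exact mul_le_mul_of_nonneg_left (hu s a) (sub_nonneg.2 h1)
  · rw [abs_mul, abs_of_nonneg h0, abs_mul, abs_of_nonneg g.γ_nonneg]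
    exact mul_le_mul_of_nonneg_left (mul_le_mul_of_nonneg_left h2 g.γ_nonneg) h0

end Noise

variable {S A : Type*} [Fintype S] [Fintype A] (g : Game S A) [DecidableEq S] [LinearOrder A]

/-- The marginals of a round of simulator samples. -/
theorem tsum_sampleLaw_mul (z : MeanField S) (x : S × A) {f : S → ℝ} (hf : ∀ s, 0 ≤ f s) :
    ∑' σ, g.sampleLaw z σ * ENNReal.ofReal (f (σ x)) =
      ENNReal.ofReal (expect (g.trans x.1 x.2 z) f) := by
  -- Expanding a product of sums with the factor `f` at coordinate `x` only integrates out all other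
  -- coordinates.
  have h := Finset.prod_univ_sum (fun _ : S × A => (Finset.univ : Finset S))
    (fun y s' => ENNReal.ofReal (g.trans y.1 y.2 z s') *
      if y = x then ENNReal.ofReal (f s') else 1)
  rw [Fintype.piFinset_univ] at h
  have h1 : ∀ y : S × A, (∑ s', ENNReal.ofReal (g.trans y.1 y.2 z s') *
      if y = x then ENNReal.ofReal (f s') else 1) =
      if y = x then ENNReal.ofReal (expect (g.trans x.1 x.2 z) f) else 1 := by
    intro y
    split_ifs with hy
    · subst hy
      unfold expect
      rw [ENNReal.ofReal_sum_of_nonneg fun s' _ => mul_nonneg (stdSimplex.zero_le _ s') (hf s')]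
      exact Finset.sum_congr rfl fun s' _ => (ENNReal.ofReal_mul (stdSimplex.zero_le _ s')).symm
    · simp only [mul_one]
      rw [← ENNReal.ofReal_sum_of_nonneg fun s' _ => stdSimplex.zero_le _ s',
        stdSimplex.sum_eq_one, ENNReal.ofReal_one]
  rw [Finset.prod_congr rfl fun y _ => h1 y, Finset.prod_ite_eq' Finset.univ] at h
  simp only [Finset.mem_univ, if_true] at h
  rw [h, tsum_fintype]
  refine Finset.sum_congr rfl fun σ _ => ?_
  rw [Finset.prod_mul_distrib, Finset.prod_ite_eq' Finset.univ]
  simp [sampleLaw, PMF.ofFintype_apply]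

variable [Nontrivial A]

/-- Law of the `t`-th iterate of synchronous TQ-learning together with its averaged sampling
errors. -/
def noisyLaw (w : ℝ) (z : MeanField S) : ℕ → PMF ((S → A → ℝ) × (S → A → ℝ))
  | 0 => PMF.pure (0, 0)
  | t + 1 => (noisyLaw w z t).bind fun x =>
      (g.sampleLaw z).map (g.noisyUpdate z (1 / ((t : ℝ) + 1) ^ w) x)

/-- The noise is a record driven by the same samples; forgetting it returns the algorithm, so joint
estimates transfer. -/
theorem map_fst_noisyLaw (w : ℝ) (z : MeanField S) (t : ℕ) :
    (g.noisyLaw w z t).map Prod.fst = g.tqLaw w z t := by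
  induction t with
  | zero => simp [noisyLaw, tqLaw, PMF.pure_map]
  | succ t ih =>
    rw [noisyLaw, tqLaw, ← ih, PMF.map_bind, PMF.bind_map]
    simp only [PMF.map_comp]
    rfl

theorem abs_le_of_mem_support_noisyLaw {w : ℝ} (hw : 0 ≤ w) (z : MeanField S) (t : ℕ)
    {x : (S → A → ℝ) × (S → A → ℝ)} (hx : x ∈ (g.noisyLaw w z t).support) :
    ∀ s a, |x.1 s a| ≤ g.Vmax ∧ |x.2 s a| ≤ 2 * g.Vmax := by
  induction t generalizing x with
  | zero =>
    rw [noisyLaw, PMF.support_pure, Set.mem_singleton_iff] at hx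
    subst hx
    simp [g.Vmax_pos.le]
  | succ t ih =>
    rw [noisyLaw, PMF.mem_support_bind_iff] at hx
    obtain ⟨y, hy, hx⟩ := hx
    rw [PMF.mem_support_map_iff] at hx
    obtain ⟨σ, -, rfl⟩ := hx
    have hy' := ih hy
    have hα := (stepSize_pos w t).le
    have hα' := stepSize_le_one hw t
    refine fun s a => ⟨abs_convex_comb_le hα hα' (hy' s a).1 ?_,
      abs_convex_comb_le hα hα' (hy' s a).2
        (g.abs_samplingError_le z (fun s a => (hy' s a).1) s a _)⟩
    rw [← g.one_add_γ_mul_Vmax]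
    refine (abs_add_le _ _).trans (add_le_add (g.abs_reward_le s a z) ?_)
    rw [abs_mul, abs_of_nonneg g.γ_nonneg]
    exact mul_le_mul_of_nonneg_left (g.abs_G_le (fun s a => (hy' s a).1) _) g.γ_nonneg

/-- Sub-Gaussian bound for the averaged sampling errors. -/
theorem tsum_noisyLaw_exp_le {w : ℝ} (hw : 0 ≤ w) (z : MeanField S) (t : ℕ) (s : S) (a : A)
    (l : ℝ) :
    ∑' x, g.noisyLaw w z t x * ENNReal.ofReal (Real.exp (l * x.2 s a)) ≤
      ENNReal.ofReal (Real.exp (l ^ 2 * (2 * g.Vmax) ^ 2 * noiseVar w t / 2)) := by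
  -- Conditioning on the past replaces `l` by `l * (1 - α)`, so the exponent must vary.
  induction t generalizing l with
  | zero =>
    rw [noisyLaw, tsum_pure_mul]
    simp [noiseVar]
  | succ t ih =>
    rw [noisyLaw, tsum_bind_mul]
    set α := 1 / ((t : ℝ) + 1) ^ w with hα
    set c := 2 * g.Vmax with hc
    have hc0 : 0 < c := mul_pos two_pos g.Vmax_pos
    have hstep : ∀ x ∈ (g.noisyLaw w z t).support,
        ∑' y, (g.sampleLaw z).map (g.noisyUpdate z α x) y *
          ENNReal.ofReal (Real.exp (l * y.2 s a)) ≤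
        ENNReal.ofReal (Real.exp (l * (1 - α) * x.2 s a)) *
          ENNReal.ofReal (Real.exp ((l * α) ^ 2 * c ^ 2 / 2)) := by
      intro x hx
      rw [tsum_map_mul]
      have h1 := g.tsum_sampleLaw_mul z (s, a) (f := fun s' =>
        Real.exp (l * ((1 - α) * x.2 s a + α * g.samplingError z x.1 s a s')))
        fun s' => (Real.exp_pos _).le
      refine h1.le.trans ?_
      rw [← ENNReal.ofReal_mul (Real.exp_pos _).le]
      refine ENNReal.ofReal_le_ofReal ?_
      have h2 : (fun s' => Real.exp (l * ((1 - α) * x.2 s a +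
          α * g.samplingError z x.1 s a s'))) = fun s' => Real.exp (l * (1 - α) * x.2 s a) *
            Real.exp (l * α * g.samplingError z x.1 s a s') := by
        funext s'
        rw [← Real.exp_add]
        congr 1
        ring
      rw [h2, expect_const_mul]
      refine mul_le_mul_of_nonneg_left ?_ (Real.exp_pos _).le
      exact expect_exp_le _ hc0 (g.abs_samplingError_le z
        (fun s a => (g.abs_le_of_mem_support_noisyLaw hw z t hx s a).1) s a)
        (g.expect_samplingError z x.1 s a) _
    calc _ ≤ ∑' x, g.noisyLaw w z t x * (ENNReal.ofReal (Real.exp (l * (1 - α) * x.2 s a)) *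
          ENNReal.ofReal (Real.exp ((l * α) ^ 2 * c ^ 2 / 2))) := by
          refine ENNReal.tsum_le_tsum fun x => ?_
          by_cases hx : x ∈ (g.noisyLaw w z t).support
          · exact mul_le_mul_right (hstep x hx) _
          · rw [PMF.mem_support_iff, not_not] at hx
            simp [hx]
      _ ≤ ENNReal.ofReal (Real.exp ((l * (1 - α)) ^ 2 * c ^ 2 * noiseVar w t / 2)) *
          ENNReal.ofReal (Real.exp ((l * α) ^ 2 * c ^ 2 / 2)) := by
          simp only [← mul_assoc]
          rw [ENNReal.tsum_mul_right]
          exact mul_le_mul_left (ih (l * (1 - α))) _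
      _ = _ := by
          rw [← ENNReal.ofReal_mul (Real.exp_pos _).le, ← Real.exp_add, noiseVar]
          congr 2
          ring

theorem noisyLaw_tail_le {w : ℝ} (hw : 0 ≤ w) (hw' : w ≤ 1) (z : MeanField S) {t : ℕ}
    (ht : 1 ≤ t) (s : S) (a : A) {b : ℝ} (hb : 0 ≤ b) :
    (g.noisyLaw w z t).toOuterMeasure {x | b < |x.2 s a|} ≤
      ENNReal.ofReal (2 * Real.exp (-(b ^ 2 * (t : ℝ) ^ w / (8 * g.Vmax ^ 2)))) := by
  obtain ⟨t, rfl⟩ : ∃ r, t = r + 1 := ⟨t - 1, by omega⟩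
  have hV := g.Vmax_pos
  set r : ℝ := ((t + 1 : ℕ) : ℝ) ^ w with hr
  have hr0 : 0 < r := by positivity
  have hv : noiseVar w (t + 1) ≤ 1 / r := by
    have := noiseVar_succ_le hw hw' t
    rwa [hr, Nat.cast_succ]
  -- Chernoff's optimal exponent: it minimizes `2 * Vmax ^ 2 * m ^ 2 / r - m * b`, with value `-(b ^
  -- 2 * r / (8 * Vmax ^ 2))`.
  set m := b * r / (4 * g.Vmax ^ 2) with hm
  have hm0 : 0 ≤ m := by positivity
  have hone : ∀ l, l ^ 2 = m ^ 2 →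
      (g.noisyLaw w z (t + 1)).toOuterMeasure {x | m * b < l * x.2 s a} ≤
        ENNReal.ofReal (Real.exp (-(b ^ 2 * r / (8 * g.Vmax ^ 2)))) := by
    intro l hl
    have h1 := mul_toOuterMeasure_le_tsum (g.noisyLaw w z (t + 1))
      (s := {x | m * b < l * x.2 s a}) (f := fun x => ENNReal.ofReal (Real.exp (l * x.2 s a)))
      (c := ENNReal.ofReal (Real.exp (m * b)))
      fun x hx => ENNReal.ofReal_le_ofReal (Real.exp_le_exp.2 (le_of_lt hx))
    have h2 := h1.trans (g.tsum_noisyLaw_exp_le hw z (t + 1) s a l)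
    have h3 : Real.exp (l ^ 2 * (2 * g.Vmax) ^ 2 * noiseVar w (t + 1) / 2) ≤
        Real.exp (m * b) * Real.exp (-(b ^ 2 * r / (8 * g.Vmax ^ 2))) := by
      rw [← Real.exp_add, Real.exp_le_exp, hl]
      have h4 : m ^ 2 * (2 * g.Vmax) ^ 2 * noiseVar w (t + 1) ≤
          m ^ 2 * (2 * g.Vmax) ^ 2 * (1 / r) := mul_le_mul_of_nonneg_left hv (by positivity)
      have h5 : m ^ 2 * (2 * g.Vmax) ^ 2 * (1 / r) / 2 =
          m * b + -(b ^ 2 * r / (8 * g.Vmax ^ 2)) := by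
        rw [hm]
        field_simp
        ring
      linarith
    have h6 := h2.trans (ENNReal.ofReal_le_ofReal h3)
    rw [ENNReal.ofReal_mul (Real.exp_pos _).le] at h6
    exact (ENNReal.mul_le_mul_iff_right (by simp [Real.exp_pos]) ENNReal.ofReal_ne_top).1 h6
  rcases hb.eq_or_lt with rfl | hb
  · refine (MeasureTheory.measure_mono (Set.subset_univ _)).trans ?_
    rw [((g.noisyLaw w z (t + 1)).toOuterMeasure_apply_eq_one_iff _).2 (Set.subset_univ _)]
    simp
  have hm1 : 0 < m := by positivity
  have hsub : {x : (S → A → ℝ) × (S → A → ℝ) | b < |x.2 s a|} ⊆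
      {x | m * b < m * x.2 s a} ∪ {x | m * b < -m * x.2 s a} := by
    intro x hx
    rcases lt_abs.1 (show b < |x.2 s a| from hx) with h | h
    · exact Or.inl (mul_lt_mul_of_pos_left h hm1)
    · refine Or.inr ?_
      show m * b < -m * x.2 s a
      have := mul_lt_mul_of_pos_left h hm1
      linarith
  refine (MeasureTheory.measure_mono hsub).trans ((MeasureTheory.measure_union_le _ _).trans ?_)
  rw [two_mul, ENNReal.ofReal_add (Real.exp_pos _).le (Real.exp_pos _).le]
  exact add_le_add (hone m rfl) (hone (-m) (by ring))

/-- Uniform tail bound for the averaged sampling errors. -/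
theorem noisyLaw_sup_tail_le {w : ℝ} (hw : 0 ≤ w) (hw' : w ≤ 1) (z : MeanField S) {t₀ t : ℕ}
    (ht₀ : 1 ≤ t₀) (ht : t₀ ≤ t) {b : ℝ} (hb : 0 ≤ b) :
    (g.noisyLaw w z t).toOuterMeasure {x | ∀ s a, |x.2 s a| ≤ b}ᶜ ≤
      ENNReal.ofReal (Fintype.card S * Fintype.card A *
        (2 * Real.exp (-(b ^ 2 * (t₀ : ℝ) ^ w / (8 * g.Vmax ^ 2))))) := by
  have hsub : {x : (S → A → ℝ) × (S → A → ℝ) | ∀ s a, |x.2 s a| ≤ b}ᶜ ⊆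
      ⋃ y ∈ (Finset.univ : Finset (S × A)), {x | b < |x.2 y.1 y.2|} := by
    intro x hx
    simp only [Set.mem_compl_iff, Set.mem_ofPred_eq, not_forall, not_le] at hx
    obtain ⟨s, a, h⟩ := hx
    simp only [Set.mem_iUnion]
    exact ⟨(s, a), Finset.mem_univ _, h⟩
  refine (MeasureTheory.measure_mono hsub).trans
    ((MeasureTheory.measure_biUnion_finset_le _ _).trans ?_)
  have h1 : ∀ y ∈ (Finset.univ : Finset (S × A)),
      (g.noisyLaw w z t).toOuterMeasure {x | b < |x.2 y.1 y.2|} ≤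
        ENNReal.ofReal (2 * Real.exp (-(b ^ 2 * (t₀ : ℝ) ^ w / (8 * g.Vmax ^ 2)))) := by
    intro y _
    refine (g.noisyLaw_tail_le hw hw' z (ht₀.trans ht) y.1 y.2 hb).trans
      (ENNReal.ofReal_le_ofReal ?_)
    gcongr
  refine (Finset.sum_le_sum h1).trans_eq ?_
  rw [Finset.sum_const, Finset.card_univ, Fintype.card_prod, nsmul_eq_mul,
    ENNReal.ofReal_mul (p := (Fintype.card S : ℝ) * Fintype.card A) (by positivity),
    ← Nat.cast_mul, ENNReal.ofReal_natCast]

/-- Contraction of the noise-free part of the TQ-learning error over a time window in which the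
step sizes are at least `m` and the averaged sampling errors exceed `b` with probability at
most `κ`. -/
theorem noisyLaw_window_le {w : ℝ} (hw : 0 ≤ w) (z : MeanField S) {t₀ n : ℕ} {m b : ℝ}
    {κ : ℝ≥0∞} (hb : 0 ≤ b) (hm : ∀ i < n, m ≤ 1 / (((t₀ + i : ℕ) : ℝ) + 1) ^ w)
    (hκ : ∀ i < n, (g.noisyLaw w z (t₀ + i)).toOuterMeasure {x | ∀ s a, |x.2 s a| ≤ b}ᶜ ≤ κ) :
    ∀ j ≤ n, (g.noisyLaw w z (t₀ + j)).toOuterMeasure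
      {x | ∀ s a, |x.1 s a - g.optQ z s a - x.2 s a| ≤
        4 * g.Vmax * Real.exp (-((1 - g.γ) * m * j)) + g.γ * b / (1 - g.γ)}ᶜ ≤ j * κ := by
  have hγ := g.one_sub_γ_pos
  have hV := g.Vmax_pos
  intro j
  induction j with
  | zero =>
    intro _
    rw [toOuterMeasure_eq_zero_of_support]
    · simp
    intro x hx
    rw [Set.notMem_compl_iff]
    intro s a
    -- The constant 4 comes from here: `Vmax` for the iterate, `Vmax` for `optQ` and `2 * Vmax` for
    -- the noise.
    obtain ⟨h1, h2⟩ := g.abs_le_of_mem_support_noisyLaw hw z _ hx s a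
    have h3 := g.abs_optQ_le z s a
    have h4 := abs_sub (x.1 s a - g.optQ z s a) (x.2 s a)
    have h5 := abs_sub (x.1 s a) (g.optQ z s a)
    have h6 : 0 ≤ g.γ * b / (1 - g.γ) := div_nonneg (mul_nonneg g.γ_nonneg hb) hγ.le
    simp only [Nat.cast_zero, mul_zero, neg_zero, Real.exp_zero, mul_one]
    linarith
  | succ j ih =>
    intro hj
    have ih := ih (by omega)
    rw [← add_assoc, noisyLaw]
    set α := 1 / (((t₀ + j : ℕ) : ℝ) + 1) ^ w with hα
    have hα0 : 0 ≤ α := (stepSize_pos w _).le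
    have hα1 : α ≤ 1 := stepSize_le_one hw _
    set e := 4 * g.Vmax * Real.exp (-((1 - g.γ) * m * j)) with he
    have he0 : 0 ≤ e := by positivity
    -- Off the bad set the bound propagates for every sample, so the step itself adds no failure
    -- probability.
    refine (toOuterMeasure_bind_le (κ := 0) (bad := {x | ∀ s a,
      |x.1 s a - g.optQ z s a - x.2 s a| ≤ e + g.γ * b / (1 - g.γ)}ᶜ ∪
        {x | ∀ s a, |x.2 s a| ≤ b}ᶜ) _ _ ?_).trans ?_
    · intro x _ hx
      rw [Set.mem_union, not_or, Set.notMem_compl_iff, Set.notMem_compl_iff] at hx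
      refine le_of_eq (toOuterMeasure_eq_zero_of_support _ fun y hy => ?_)
      rw [PMF.mem_support_map_iff] at hy
      obtain ⟨σ, -, rfl⟩ := hy
      rw [Set.notMem_compl_iff]
      intro s a
      refine (g.abs_noisyUpdate_sub_le z hα0 hα1 hx.1 hx.2 σ s a).trans ?_
      -- `γ b / (1 - γ)` is the fixed point of `u ↦ γ (u + b)`; only the excess `e` over it
      -- contracts.
      have e1 : (1 - α) * (e + g.γ * b / (1 - g.γ)) +
          α * (g.γ * (e + g.γ * b / (1 - g.γ) + b)) =
            (1 - (1 - g.γ) * α) * e + g.γ * b / (1 - g.γ) := by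
        field_simp
        ring
      have e2 : 1 - (1 - g.γ) * α ≤ Real.exp (-((1 - g.γ) * m)) := by
        have := Real.add_one_le_exp (-((1 - g.γ) * m))
        have := mul_le_mul_of_nonneg_left (hm j (by omega)) hγ.le
        linarith
      have e3 : 4 * g.Vmax * Real.exp (-((1 - g.γ) * m * ((j + 1 : ℕ) : ℝ))) =
          Real.exp (-((1 - g.γ) * m)) * e := by
        rw [he, mul_left_comm, ← Real.exp_add]
        push_cast
        congr 2
        ring
      rw [e1, e3]
      have := mul_le_mul_of_nonneg_right e2 he0
      linarith
    · rw [add_zero, Nat.cast_succ, add_mul, one_mul]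
      exact (MeasureTheory.measure_union_le _ _).trans (add_le_add ih (hκ j (by omega)))

/-- Finite-time error bound for synchronous TQ-learning after `t₀ + n` updates. -/
theorem tqLaw_error_le {w : ℝ} (hw : 0 ≤ w) (hw' : w ≤ 1) (z : MeanField S) {t₀ n : ℕ}
    (ht₀ : 1 ≤ t₀) {b : ℝ} (hb : 0 ≤ b) :
    (g.tqLaw w z (t₀ + n)).toOuterMeasure {Q | ‖g.optQ z - Q‖ ≤
      4 * g.Vmax * Real.exp (-((1 - g.γ) * (n / ((t₀ + n : ℕ) : ℝ) ^ w))) +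
        b / (1 - g.γ)}ᶜ ≤
      ENNReal.ofReal ((n + 1) * (Fintype.card S * Fintype.card A *
        (2 * Real.exp (-(b ^ 2 * (t₀ : ℝ) ^ w / (8 * g.Vmax ^ 2)))))) := by
  have hγ := g.one_sub_γ_pos
  have hV := g.Vmax_pos
  have hm : ∀ i < n, 1 / ((t₀ + n : ℕ) : ℝ) ^ w ≤ 1 / (((t₀ + i : ℕ) : ℝ) + 1) ^ w := by
    intro i hi
    refine one_div_le_one_div_of_le (by positivity) (Real.rpow_le_rpow (by positivity) ?_ hw)
    exact_mod_cast (by omega : t₀ + i + 1 ≤ t₀ + n)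
  have h1 := g.noisyLaw_window_le hw z hb hm
    (fun i _ => g.noisyLaw_sup_tail_le hw hw' z ht₀ (Nat.le_add_right t₀ i) hb) n le_rfl
  -- The noise at the final time is one more event, whence `n + 1`; adding it back to the remainder
  -- gives `γ b / (1 - γ) + b = b / (1 - γ)`.
  have h2 := g.noisyLaw_sup_tail_le hw hw' z ht₀ (Nat.le_add_right t₀ n) hb
  rw [← map_fst_noisyLaw, PMF.toOuterMeasure_map_apply]
  refine le_trans (MeasureTheory.measure_mono ?_) ((MeasureTheory.measure_union_le _ _).trans
    ((add_le_add h1 h2).trans_eq ?_))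
  · rw [← Set.compl_inter, Set.preimage_compl, Set.compl_subset_compl]
    rintro x ⟨hx1, hx2⟩
    refine norm_le_of_forall_abs_le (by positivity) fun s a => ?_
    have h3 := hx1 s a
    have h4 := hx2 s a
    have h5 := abs_add_le (x.1 s a - g.optQ z s a - x.2 s a) (x.2 s a)
    have h6 : b / (1 - g.γ) = g.γ * b / (1 - g.γ) + b := by
      field_simp
      ring
    rw [sub_add_cancel] at h5
    rw [Pi.sub_apply, Pi.sub_apply, abs_sub_comm, h6]
    rw [show (1 - g.γ) * (n / ((t₀ + n : ℕ) : ℝ) ^ w) =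
      (1 - g.γ) * (1 / ((t₀ + n : ℕ) : ℝ) ^ w) * n by ring]
    linarith
  · rw [ENNReal.ofReal_mul (p := (n : ℝ) + 1) (by positivity), ENNReal.ofReal_add (by positivity) zero_le_one,
      ENNReal.ofReal_natCast, ENNReal.ofReal_one, add_mul, one_mul]

end Game

/-- The sample size makes the initial bias of TQ-learning negligible. -/
theorem log_le_of_sampleSize {w β x X c I : ℝ} (hw' : w < 1) (hβ : 0 < β) (hx : 1 ≤ x)
    (hβx : 1 ≤ 2 * β * x) (hX : 1 ≤ X) (hc0 : 0 ≤ c) (hc : 32 ≤ c ^ (1 - w))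
    (hI : c * (X + (1 / β * Real.log x) ^ (1 / (1 - w))) ≤ I) :
    Real.log (8 * x) ≤ β * I ^ (1 - w) / 2 := by
  have h1w : 0 < 1 - w := sub_pos.2 hw'
  have hlog : 0 ≤ Real.log x := Real.log_nonneg hx
  have hY0 : 0 ≤ 1 / β * Real.log x := by positivity
  set Y := 1 / β * Real.log x with hY
  have hYp : 0 ≤ Y ^ (1 / (1 - w)) := by positivity
  have h8 : Real.log (8 * x) = 3 * Real.log 2 + Real.log x := by
    rw [Real.log_mul (by norm_num) (by positivity), show (8 : ℝ) = 2 ^ 3 by norm_num, Real.log_pow]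
    norm_num
  have hl2 := Real.log_two_lt_d9
  rw [h8]
  -- For `x ≥ 2`, `log (8 x) ≤ 4 log x`, which the logarithmic summand controls. For `x` near 1 that
  -- summand may vanish; then `β ≥ 1 / 4` and `X ≥ 1` suffice.
  rcases le_total 2 x with hx2 | hx2
  · have h1 : (c * Y ^ (1 / (1 - w))) ^ (1 - w) ≤ I ^ (1 - w) := by
      refine Real.rpow_le_rpow (by positivity) (le_trans ?_ hI) h1w.le
      exact mul_le_mul_of_nonneg_left (by linarith) hc0
    rw [Real.mul_rpow hc0 hYp, ← Real.rpow_mul hY0, one_div_mul_cancel h1w.ne', Real.rpow_one] at h1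
    have h2 : 32 * Y ≤ I ^ (1 - w) := (mul_le_mul_of_nonneg_right hc hY0).trans h1
    have h3 : β * (32 * Y) = 32 * Real.log x := by
      rw [hY]
      field_simp
    have h4 := mul_le_mul_of_nonneg_left h2 hβ.le
    have h5 : Real.log 2 ≤ Real.log x := Real.log_le_log (by norm_num) hx2
    linarith
  · have h1 : 32 ≤ I ^ (1 - w) := hc.trans (Real.rpow_le_rpow hc0 (le_trans (by nlinarith) hI) h1w.le)
    have h2 : 1 / 4 ≤ β := by nlinarith
    have h3 : Real.log x ≤ Real.log 2 := Real.log_le_log (by linarith) hx2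
    nlinarith

/-- The sample size makes the averaged sampling errors of TQ-learning negligible, uniformly over
a window of at most `I` updates. -/
theorem mul_le_exp_of_sampleSize {w K L m c I : ℝ} (hw : 1 / 2 < w) (hK : 1 ≤ K) (hL : 1 ≤ L)
    (hm : 0 < m) (hmL : Real.log m ≤ L) (hKL : Real.log K ≤ 2 * L) (hc : 10 ^ 12 ≤ c)
    (hI : c * (K * L) ^ (1 / w) ≤ I) : I * m ≤ Real.exp (I ^ w / K / 16) := by
  have hw0 : 0 < w := by linarith
  have hc0 : 0 ≤ c := le_trans (by norm_num) hc
  have hKL0 : 1 ≤ K * L := by nlinarith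
  have hI1 : 1 ≤ I := by
    have := Real.one_le_rpow hKL0 (one_div_pos.2 hw0).le
    nlinarith
  -- `w > 1 / 2` enters here and in `hlogI2`, where dividing by `w` costs at most a factor 2.
  have hcw : (10 : ℝ) ^ 6 ≤ c ^ w := by
    calc (10 : ℝ) ^ 6 = ((10 : ℝ) ^ 12) ^ (1 / 2 : ℝ) := by
          rw [← Real.sqrt_eq_rpow, show (10 : ℝ) ^ 12 = (10 ^ 6) ^ 2 by norm_num,
            Real.sqrt_sq (by norm_num)]
      _ ≤ c ^ (1 / 2 : ℝ) := Real.rpow_le_rpow (by norm_num) hc (by norm_num)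
      _ ≤ c ^ w := Real.rpow_le_rpow_of_exponent_le (le_trans (by norm_num) hc) hw.le
  have hIw : c ^ w * (K * L) ≤ I ^ w := by
    have := Real.rpow_le_rpow (by positivity) hI hw0.le
    rwa [Real.mul_rpow hc0 (by positivity), ← Real.rpow_mul (by linarith),
      one_div_mul_cancel hw0.ne', Real.rpow_one] at this
  set y := I ^ w / K with hy
  have hyL : 10 ^ 6 * L ≤ y := by
    rw [hy, le_div_iff₀ (by linarith)]
    have := mul_le_mul_of_nonneg_right hcw (by linarith : 0 ≤ K * L)
    linarith
  have hy0 : 0 < y := by linarith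
  have hlogI : w * Real.log I = Real.log y + Real.log K := by
    rw [← Real.log_mul hy0.ne' (by linarith), hy, div_mul_cancel₀ _ (by linarith),
      Real.log_rpow (by linarith)]
  have hlogI0 : 0 ≤ Real.log I := Real.log_nonneg hI1
  have hlogI2 : Real.log I ≤ 2 * (Real.log y + Real.log K) := by nlinarith
  -- A linear bound of small slope; its constant, like the multiples of `L`, is absorbed through `10
  -- ^ 6 * L ≤ y` and `L ≥ 1`.
  have hlogy : Real.log y ≤ y / 400 + 399 := by
    have h1 := Real.log_le_sub_one_of_pos (show (0 : ℝ) < y / 400 by positivity)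
    have h2 := Real.log_le_sub_one_of_pos (show (0 : ℝ) < 400 by norm_num)
    rw [Real.log_div hy0.ne' (by norm_num)] at h1
    linarith
  rw [← Real.log_le_iff_le_exp (by positivity), Real.log_mul (by linarith) hm.ne']
  linarith

/-! ### Sample complexity, and propagation of errors through the iterations. -/

namespace Game

variable {S A : Type*} [Fintype S] [Fintype A] (g : Game S A)

theorem β_pos : 0 < g.β := half_pos g.one_sub_γ_pos

theorem two_mul_β_mul_Vmax : 2 * g.β * g.Vmax = 1 := by
  have := g.one_sub_γ_pos.ne'
  unfold β Vmax
  field_simp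

theorem β_le_half : g.β ≤ 1 / 2 := by
  unfold β
  linarith [g.γ_nonneg]

theorem one_le_constB (C₁ C₂ C₃ : ℝ) (k₀ : ℕ) : 1 ≤ g.constB C₁ C₂ C₃ k₀ := le_max_left _ _

theorem constA_nonneg {C₁ C₂ C₃ : ℝ} (hC₂ : 0 ≤ C₂) : 0 ≤ g.constA C₁ C₂ C₃ :=
  le_trans (by linarith) (le_max_left _ _)

theorem nonempty_states (g : Game S A) : Nonempty S := by
  by_contra h
  rw [not_nonempty_iff] at h
  have := stdSimplex.sum_eq_one g.regen
  simp at this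

/-- Numerical consequences of the sample size condition. -/
theorem sampleBound_spec [Nonempty A] {w c : ℝ} (hw : 1 / 2 < w) (hw' : w < 1) (hc : 10 ^ 12 ≤ c)
    (hc' : 32 ≤ c ^ (1 - w)) {C₁ C₂ C₃ : ℝ} {η δ : ℝ} (hη : 0 < η) (hη' : η < 1) (hδ : 0 < δ)
    (hδ' : δ < 1) {k₀ : ℕ} (hk₀ : 1 ≤ k₀) {I : ℝ}
    (hI : c * g.sampleBound C₁ C₂ C₃ w η δ k₀ ≤ I) :
    2 ≤ I ∧
    Real.log (8 * (g.Vmax * g.constB C₁ C₂ C₃ k₀ / η)) ≤ g.β * I ^ (1 - w) / 2 ∧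
    I * (2 * k₀ * (Fintype.card S * Fintype.card A) / δ) ≤
      Real.exp (I ^ w / (g.Vmax * g.constB C₁ C₂ C₃ k₀ / η / g.β) ^ 2 / 16) := by
  have hw0 : 0 < w := by linarith
  have hc0 : 0 ≤ c := le_trans (by norm_num) hc
  have hβ := g.β_pos
  have hβ2 := g.β_le_half
  have hV := g.one_le_Vmax
  have hβV := g.two_mul_β_mul_Vmax
  have hB := g.one_le_constB C₁ C₂ C₃ k₀
  have hcardS : (1 : ℝ) ≤ Fintype.card S := by
    have := g.nonempty_states
    exact_mod_cast Fintype.card_pos (α := S)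
  have hcardA : (1 : ℝ) ≤ Fintype.card A := by exact_mod_cast Fintype.card_pos (α := A)
  have hN1 : (1 : ℝ) ≤ Fintype.card S * Fintype.card A :=
    one_le_mul_of_one_le_of_one_le hcardS hcardA
  have hk : (1 : ℝ) ≤ k₀ := by exact_mod_cast hk₀
  unfold sampleBound at hI
  generalize g.Vmax = V at *
  generalize g.constB C₁ C₂ C₃ k₀ = B at *
  generalize g.β = β at *
  generalize (Fintype.card S : ℝ) * Fintype.card A = N at *
  have hx1 : 1 ≤ V * B / η := by
    rw [le_div_iff₀ hη]
    linarith [one_le_mul_of_one_le_of_one_le hV hB]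
  have hxV : V ≤ V * B / η := by
    rw [le_div_iff₀ hη]
    exact mul_le_mul_of_nonneg_left (hη'.le.trans hB) (by linarith)
  have hxβ : 2 ≤ V * B / η / β := by
    rw [le_div_iff₀ hβ]
    linarith
  have hm2 : 2 ≤ 2 * k₀ * N / δ := by
    rw [le_div_iff₀ hδ]
    linarith [one_le_mul_of_one_le_of_one_le hk hN1]
  -- The logarithm splits into a union-bound part and an accuracy part. Each is at least `log 2`, so
  -- their sum is at least 1 and dominates both.
  have hL : Real.log (2 * k₀ * N * V * B / (δ * β * η)) =
      Real.log (2 * k₀ * N / δ) + Real.log (V * B / η / β) := by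
    rw [← Real.log_mul (by positivity) (by positivity)]
    congr 1
    field_simp
  have hl2 := Real.log_two_gt_d9
  have hlogm : Real.log 2 ≤ Real.log (2 * k₀ * N / δ) := Real.log_le_log (by norm_num) hm2
  have hlogx : Real.log 2 ≤ Real.log (V * B / η / β) := Real.log_le_log (by norm_num) hxβ
  generalize Real.log (2 * k₀ * N * V * B / (δ * β * η)) = L at *
  have hL1 : 1 ≤ L := by linarith
  have hX : V ^ 2 * B ^ 2 * L / (β ^ 2 * η ^ 2) = (V * B / η / β) ^ 2 * L := by
    field_simp
  rw [hX] at hI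
  generalize V * B / η = x at *
  have hK1 : 1 ≤ (x / β) ^ 2 := one_le_pow₀ (by linarith)
  have hX1 : 1 ≤ ((x / β) ^ 2 * L) ^ (1 / w) :=
    Real.one_le_rpow (one_le_mul_of_one_le_of_one_le hK1 hL1) (one_div_pos.2 hw0).le
  have hY0 : 0 ≤ (1 / β * Real.log x) ^ (1 / (1 - w)) := by
    have := Real.log_nonneg hx1
    positivity
  have hI2 := mul_le_mul hc (le_add_of_le_of_nonneg hX1 hY0) zero_le_one hc0
  have hβx := mul_le_mul_of_nonneg_left hxV (show 0 ≤ 2 * β by linarith)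
  refine ⟨by linarith, log_le_of_sampleSize hw' hβ hx1 (hβV.symm.le.trans hβx) hX1 hc0 hc' hI,
    mul_le_exp_of_sampleSize hw hK1 hL1 (by linarith) (by linarith) ?_ hc
      (le_trans (mul_le_mul_of_nonneg_left (by linarith) hc0) hI)⟩
  rw [Real.log_pow]
  push_cast
  linarith

variable [DecidableEq S] [LinearOrder A] [Nontrivial A]

/-- Sample complexity of synchronous TQ-learning. -/
theorem tqLaw_accuracy {w c : ℝ} (hw : 1 / 2 < w) (hw' : w < 1) (hc : 10 ^ 12 ≤ c)
    (hc' : 32 ≤ c ^ (1 - w)) (C₁ C₂ C₃ : ℝ) {η δ : ℝ} (hη : 0 < η) (hη' : η < 1) (hδ : 0 < δ)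
    (hδ' : δ < 1) {k₀ : ℕ} (hk₀ : 1 ≤ k₀) {I : ℕ}
    (hI : c * g.sampleBound C₁ C₂ C₃ w η δ k₀ ≤ I) (z : MeanField S) :
    (g.tqLaw w z I).toOuterMeasure {Q | ‖g.optQ z - Q‖ ≤ η / g.constB C₁ C₂ C₃ k₀}ᶜ ≤
      ENNReal.ofReal (δ / k₀) := by
  have hw0 : 0 < w := by linarith
  have hβ := g.β_pos
  have hV := g.Vmax_pos
  have hB : 0 < g.constB C₁ C₂ C₃ k₀ := lt_of_lt_of_le one_pos (g.one_le_constB C₁ C₂ C₃ k₀)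
  have hγβ : 1 - g.γ = 2 * g.β := by
    unfold β
    ring
  have hk : (0 : ℝ) < k₀ := by exact_mod_cast hk₀
  have hcardS : (0 : ℝ) < Fintype.card S := by
    have := g.nonempty_states
    exact_mod_cast Fintype.card_pos (α := S)
  have hcardA : (0 : ℝ) < Fintype.card A := by exact_mod_cast Fintype.card_pos (α := A)
  obtain ⟨hI2, hbias, hvar⟩ := g.sampleBound_spec hw hw' hc hc' hη hη' hδ hδ' hk₀ hI
  obtain ⟨t₀, n, hsum, hn, hnt, htn⟩ : ∃ t₀ n : ℕ, I = t₀ + n ∧ 1 ≤ n ∧ n ≤ t₀ ∧ t₀ ≤ n + 1 := by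
    have : 2 ≤ I := by exact_mod_cast hI2
    exact ⟨I - I / 2, I / 2, by omega, by omega, by omega, by omega⟩
  have hIR : (I : ℝ) = t₀ + n := by exact_mod_cast hsum
  have hntR : (n : ℝ) ≤ t₀ := by exact_mod_cast hnt
  have htnR : (t₀ : ℝ) ≤ n + 1 := by exact_mod_cast htn
  have hnR : (1 : ℝ) ≤ n := by exact_mod_cast hn
  have hI0 : (0 : ℝ) < I := by linarith
  -- With `1 - γ = 2 β`, the noise level `b = β η / B` contributes `b / (1 - γ) = η / (2 B)`, half
  -- of the accuracy; the initial bias gets the other half.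
  have hb : 0 ≤ g.β * (η / g.constB C₁ C₂ C₃ k₀) := by positivity
  have hmain := g.tqLaw_error_le hw0.le hw'.le z (t₀ := t₀) (n := n) (by omega) hb
  rw [← hsum] at hmain
  refine (MeasureTheory.measure_mono (Set.compl_subset_compl.2 fun Q hQ =>
    le_trans (show ‖g.optQ z - Q‖ ≤ _ from hQ) ?_)).trans
    (hmain.trans (ENNReal.ofReal_le_ofReal ?_))
  · clear hQ hmain hvar
    rw [hγβ]
    generalize g.Vmax = V at *
    generalize g.constB C₁ C₂ C₃ k₀ = B at *
    generalize g.β = β at *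
    have h1 : β * (η / B) / (2 * β) = η / B / 2 := by
      field_simp
    have h2 : Real.log (8 * (V * B / η)) ≤ 2 * β * (n / (I : ℝ) ^ w) := by
      refine hbias.trans ?_
      rw [Real.rpow_sub hI0, Real.rpow_one]
      have : (I : ℝ) / I ^ w ≤ 4 * n / (I : ℝ) ^ w :=
        div_le_div_of_nonneg_right (by linarith) (by positivity)
      have := mul_le_mul_of_nonneg_left this hβ.le
      linarith [show 2 * β * (n / (I : ℝ) ^ w) = β * (4 * n / (I : ℝ) ^ w) / 2 by ring]
    have h3 : Real.exp (-(2 * β * (n / (I : ℝ) ^ w))) ≤ (8 * (V * B / η))⁻¹ := by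
      rw [Real.exp_neg]
      refine inv_anti₀ (by positivity) ?_
      rwa [← Real.log_le_iff_le_exp (by positivity)]
    have h4 : 4 * V * (8 * (V * B / η))⁻¹ = η / B / 2 := by
      field_simp
      norm_num
    have h5 := mul_le_mul_of_nonneg_left h3 (show 0 ≤ 4 * V by positivity)
    linarith
  · clear hmain hbias
    generalize g.Vmax = V at *
    generalize g.constB C₁ C₂ C₃ k₀ = B at *
    generalize g.β = β at *
    have h1 : (I : ℝ) ^ w / (V * B / η / β) ^ 2 / 16 ≤
        (β * (η / B)) ^ 2 * (t₀ : ℝ) ^ w / (8 * V ^ 2) := by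
      have h2 : (I : ℝ) ^ w / 2 ≤ (t₀ : ℝ) ^ w := by
        have h3 : ((I : ℝ) / 2) ^ w ≤ (t₀ : ℝ) ^ w :=
          Real.rpow_le_rpow (by positivity) (by linarith) hw0.le
        rw [Real.div_rpow hI0.le (by norm_num)] at h3
        have h4 : (2 : ℝ) ^ w ≤ 2 := Real.rpow_le_self_of_one_le (by norm_num) hw'.le
        exact (div_le_div_of_nonneg_left (by positivity) (by positivity) h4).trans h3
      have h5 : (β * (η / B)) ^ 2 * (t₀ : ℝ) ^ w / (8 * V ^ 2) =
          (t₀ : ℝ) ^ w / (V * B / η / β) ^ 2 / 8 := by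
        field_simp
      rw [h5]
      have := div_le_div_of_nonneg_right h2 (sq_nonneg (V * B / η / β))
      linarith [show (I : ℝ) ^ w / 2 / (V * B / η / β) ^ 2 =
        (I : ℝ) ^ w / (V * B / η / β) ^ 2 / 2 by ring]
    have h6 : Real.exp (-((β * (η / B)) ^ 2 * (t₀ : ℝ) ^ w / (8 * V ^ 2))) ≤
        (I * (2 * k₀ * (Fintype.card S * Fintype.card A) / δ))⁻¹ := by
      rw [Real.exp_neg]
      exact inv_anti₀ (by positivity) (hvar.trans (Real.exp_le_exp.2 h1))
    calc _ ≤ (I : ℝ) * (Fintype.card S * Fintype.card A *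
          (2 * (I * (2 * k₀ * (Fintype.card S * Fintype.card A) / δ))⁻¹)) := by
          gcongr
          linarith
      _ = δ / k₀ := by
          field_simp

/-- Propagation of the TQ-learning errors through the mean-field updates: outside an event of
probability `k κ`, the mean fields of online TMFQ-learning and of modified T-BR are close. -/
theorem onlineLaw_error_le {C₁ C₂ C₃ : ℝ} (hL : g.LipschitzAssumption C₁ C₂ C₃) {w : ℝ} {I : ℕ}
    {τ : ℝ} (hτ : 0 ≤ τ) {κ : ℝ≥0∞}
    (hκ : ∀ z, (g.tqLaw w z I).toOuterMeasure {Q | ‖g.optQ z - Q‖ ≤ τ}ᶜ ≤ κ)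
    (z₀ : MeanField S) (μ₀ : Strategy S A) {E : ℕ → ℝ} (hE0 : ∀ k, 0 ≤ E k)
    (hE : Monotone E)
    (hEs : ∀ k, (1 - g.ζ) * ((1 + C₂) * E k + C₃ * (g.constD C₁ C₂ * E k + τ)) ≤ E (k + 1))
    (k : ℕ) :
    (g.onlineLaw w I z₀ μ₀ k).toOuterMeasure
      {x | l1Dist x.1 (g.modTBR z₀ μ₀ k).1 ≤ E k ∧ ∀ z s,
        ∑ s', |g.transUnder z x.2 s s' - g.transUnder z (g.modTBR z₀ μ₀ k).2 s s'| ≤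
          C₃ * (g.constD C₁ C₂ * E k + τ)}ᶜ ≤ k * κ := by
  have hζ : 0 ≤ 1 - g.ζ := sub_nonneg.2 g.ζ_le_one
  have hC₁ := hL.C₁_nonneg
  have hC₂ := hL.C₂_nonneg
  have hC₃ := hL.C₃_nonneg
  have hD : 0 ≤ g.constD C₁ C₂ := by
    have := g.one_sub_γ_pos
    have := g.γ_nonneg
    unfold constD
    positivity
  -- Entries 0 and 1 are deterministic and common to both algorithms.
  have hpure : ∀ (k : ℕ) (y : MeanField S × Strategy S A),
      (PMF.pure y).toOuterMeasure
      {x | l1Dist x.1 y.1 ≤ E k ∧ ∀ z s,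
        ∑ s', |g.transUnder z x.2 s s' - g.transUnder z y.2 s s'| ≤
          C₃ * (g.constD C₁ C₂ * E k + τ)}ᶜ ≤ k * κ := by
    intro k y
    rw [toOuterMeasure_eq_zero_of_support]
    · exact bot_le
    intro x hx
    rw [PMF.support_pure, Set.mem_singleton_iff] at hx
    subst hx
    rw [Set.notMem_compl_iff]
    have := hE0 k
    refine ⟨by rw [l1Dist_self]; exact this, fun z s => ?_⟩
    simp only [sub_self, abs_zero, Finset.sum_const_zero]
    positivity
  induction k with
  | zero => exact hpure 0 _
  | succ k ih =>
    cases k with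
    | zero => exact hpure 1 _
    | succ k =>
      rw [onlineLaw, Nat.cast_succ (k + 1), add_mul, one_mul]
      refine (toOuterMeasure_bind_le _ _ ?_).trans (add_le_add ih le_rfl)
      intro x _ hx
      rw [Set.notMem_compl_iff] at hx
      obtain ⟨hx1, hx2⟩ := hx
      rw [PMF.toOuterMeasure_map_apply, Set.preimage_compl]
      refine (MeasureTheory.measure_mono (Set.compl_subset_compl.2 fun Q hQ => ?_)).trans
        (hκ x.1)
      have hQ' : ‖g.optQ x.1 - Q‖ ≤ τ := hQ
      refine ⟨?_, fun z s => ?_⟩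
      · refine le_trans ?_ (hEs (k + 1))
        refine (g.l1Dist_Phi_le (fun s a => hL.trans_lip s a _ _) (hx2 _)).trans ?_
        gcongr
      · have h1 := hL.strategy_lip z (g.modTBR z₀ μ₀ (k + 1)).1 Q s
        simp only [abs_sub_comm] at h1 ⊢
        refine h1.trans (mul_le_mul_of_nonneg_left ?_ hC₃)
        have h2 := norm_sub_le_norm_sub_add_norm_sub (g.optQ (g.modTBR z₀ μ₀ (k + 1)).1)
          (g.optQ x.1) Q
        have h3 := g.norm_optQ_sub_le hL (g.modTBR z₀ μ₀ (k + 1)).1 x.1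
        rw [l1Dist_comm] at h3
        -- The stored strategy was computed at the previous mean field, so its error is governed by
        -- the earlier value of `E`; monotonicity passes to the current one.
        have h4 := mul_le_mul_of_nonneg_left (hx1.trans (hE (Nat.le_succ (k + 1)))) hD
        linarith

/-- If TQ-learning is `η / B`-accurate with failure probability `κ`, online TMFQ-learning is
`η`-close to modified T-BR after `k₀` iterations. -/
theorem onlineLaw_l1Dist_le {C₁ C₂ C₃ : ℝ} (hL : g.LipschitzAssumption C₁ C₂ C₃) {w : ℝ} {I : ℕ}
    {η : ℝ} (hη : 0 < η) {k₀ : ℕ} {κ : ℝ≥0∞}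
    (hκ : ∀ z, (g.tqLaw w z I).toOuterMeasure
      {Q | ‖g.optQ z - Q‖ ≤ η / g.constB C₁ C₂ C₃ k₀}ᶜ ≤ κ)
    (z₀ : MeanField S) (μ₀ : Strategy S A) :
    (g.onlineLaw w I z₀ μ₀ k₀).toOuterMeasure
      {x | l1Dist x.1 (g.modTBR z₀ μ₀ k₀).1 ≤ η}ᶜ ≤ k₀ * κ := by
  have hζ : 0 ≤ 1 - g.ζ := sub_nonneg.2 g.ζ_le_one
  have hC₃ := hL.C₃_nonneg
  have hM := g.constA_nonneg (C₁ := C₁) (C₃ := C₃) hL.C₂_nonneg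
  have hB0 : 0 < g.constB C₁ C₂ C₃ k₀ := lt_of_lt_of_le one_pos (g.one_le_constB C₁ C₂ C₃ k₀)
  set τ := η / g.constB C₁ C₂ C₃ k₀ with hτdef
  have hτ : 0 ≤ τ := by positivity
  set q := 2 * (1 - g.ζ) * g.constA C₁ C₂ C₃ with hq
  have hq0 : 0 ≤ q := by positivity
  -- The solution of `E (k + 1) = q * E k + (1 - ζ) * C₃ * τ` with `E 0 = 0`. The 2 in `q` comes
  -- from bounding both `1 + C₂` and `C₃ D` by `constA`.
  set E : ℕ → ℝ := fun k => (1 - g.ζ) * C₃ * (∑ j ∈ Finset.range k, q ^ j) * τ with hE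
  have hE0 : ∀ k, 0 ≤ E k := fun k => by positivity
  have hmono : Monotone E := by
    refine monotone_nat_of_le_succ fun k => ?_
    simp only [hE, Finset.sum_range_succ]
    gcongr
    linarith [pow_nonneg hq0 k]
  have hEs : ∀ k, (1 - g.ζ) * ((1 + C₂) * E k + C₃ * (g.constD C₁ C₂ * E k + τ)) ≤ E (k + 1) := by
    intro k
    have h1 : E (k + 1) = q * E k + (1 - g.ζ) * (C₃ * τ) := by
      simp only [hE, Finset.sum_range_succ', pow_succ', pow_zero, ← Finset.mul_sum]
      ring
    have h2 : (1 + C₂) * E k ≤ g.constA C₁ C₂ C₃ * E k :=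
      mul_le_mul_of_nonneg_right (le_max_left _ _) (hE0 k)
    have h3 : C₃ * g.constD C₁ C₂ * E k ≤ g.constA C₁ C₂ C₃ * E k :=
      mul_le_mul_of_nonneg_right (le_max_right _ _) (hE0 k)
    rw [h1, show q * E k + (1 - g.ζ) * (C₃ * τ) =
      (1 - g.ζ) * (g.constA C₁ C₂ C₃ * E k + g.constA C₁ C₂ C₃ * E k + C₃ * τ) by rw [hq]; ring]
    exact mul_le_mul_of_nonneg_left (by linarith) hζ
  refine (MeasureTheory.measure_mono (Set.compl_subset_compl.2 ?_)).trans
    (g.onlineLaw_error_le hL hτ hκ z₀ μ₀ hE0 hmono hEs k₀)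
  rintro x ⟨hx, -⟩
  refine hx.trans ?_
  calc E k₀ ≤ g.constB C₁ C₂ C₃ k₀ * τ := mul_le_mul_of_nonneg_right (le_max_right _ _) hτ
    _ = η := mul_div_cancel₀ _ hB0.ne'

/-- Sample complexity of online TMFQ-learning. -/
theorem onlineLaw_accuracy {C₁ C₂ C₃ : ℝ} (hL : g.LipschitzAssumption C₁ C₂ C₃) {w c : ℝ}
    (hw : 1 / 2 < w) (hw' : w < 1) (hc : 10 ^ 12 ≤ c) (hc' : 32 ≤ c ^ (1 - w))
    (z₀ : MeanField S) (μ₀ : Strategy S A) (z : MeanField S) {η δ : ℝ} (hη : 0 < η) (hη' : η < 1)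
    (hδ : 0 < δ) (hδ' : δ < 1) {k₀ : ℕ} (hk₀ : l1Dist (g.modTBR z₀ μ₀ k₀).1 z ≤ η) {I : ℕ}
    (hI : c * g.sampleBound C₁ C₂ C₃ w η δ k₀ ≤ I) :
    ENNReal.ofReal (1 - δ) ≤
      (g.onlineLaw w I z₀ μ₀ k₀).toOuterMeasure {x | l1Dist x.1 z ≤ 2 * η} := by
  have hfail : (g.onlineLaw w I z₀ μ₀ k₀).toOuterMeasure
      {x | l1Dist x.1 (g.modTBR z₀ μ₀ k₀).1 ≤ η}ᶜ ≤ ENNReal.ofReal δ := by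
    -- For `k₀ = 0` nothing has been learned, both mean fields are `z₀`, and `δ / k₀` would be
    -- meaningless.
    rcases Nat.eq_zero_or_pos k₀ with rfl | hpos
    · rw [onlineLaw, toOuterMeasure_eq_zero_of_support]
      · exact bot_le
      intro x hx
      rw [PMF.support_pure, Set.mem_singleton_iff] at hx
      subst hx
      rw [Set.notMem_compl_iff]
      exact (l1Dist_self z₀).trans_le hη.le
    · refine (g.onlineLaw_l1Dist_le hL hη
        (g.tqLaw_accuracy hw hw' hc hc' C₁ C₂ C₃ hη hη' hδ hδ' hpos hI) z₀ μ₀).trans_eq ?_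
      rw [← ENNReal.ofReal_natCast, ← ENNReal.ofReal_mul (Nat.cast_nonneg _)]
      congr 1
      have : (k₀ : ℝ) ≠ 0 := by exact_mod_cast hpos.ne'
      field_simp
  rw [ENNReal.ofReal_sub _ hδ.le, ENNReal.ofReal_one]
  refine (one_sub_le_toOuterMeasure _ hfail).trans (MeasureTheory.measure_mono fun x hx => ?_)
  have h1 : l1Dist x.1 (g.modTBR z₀ μ₀ k₀).1 ≤ η := hx
  have h2 := l1Dist_triangle x.1 (g.modTBR z₀ μ₀ k₀).1 z
  show l1Dist x.1 z ≤ 2 * η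
  linarith

end Game

end TMFG

end

theorem mainTheorem5 (w : ℝ) (hw : 1 / 2 < w) (hw' : w < 1) :
    ∃ c : ℝ, 0 < c ∧
      ∀ (S A : Type*) [Fintype S] [DecidableEq S] [Lattice S] [Fintype A] [LinearOrder A]
        [Nontrivial A] (g : TMFG.Game S A) (C₁ C₂ C₃ : ℝ),
        g.StrategicComplementarities → g.LipschitzAssumption C₁ C₂ C₃ →
        -- modified T-BR converges to a T-MFE
        (∀ (z₀ : TMFG.MeanField S) (μ₀ : TMFG.Strategy S A),
          (∀ z, TMFG.SDLe z₀ z) →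
          (∀ s s', s ≤ s' → TMFG.SDLe (μ₀ s) (μ₀ s')) →
          (∀ s, TMFG.SDLe (μ₀ s) (g.bestResponse z₀ s)) →
          ∃ zStar : TMFG.MeanField S, g.IsTMFE zStar (g.bestResponse zStar) ∧
            Filter.Tendsto (fun k => TMFG.l1Dist (g.modTBR z₀ μ₀ k).1 zStar)
              Filter.atTop (nhds 0)) ∧
        -- sample complexity of online TMFQ-learning
        (∀ (z₀ : TMFG.MeanField S) (μ₀ : TMFG.Strategy S A)
          (zStar : TMFG.MeanField S) (μStar : TMFG.Strategy S A), g.IsTMFE zStar μStar →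
          ∀ η δ : ℝ, 0 < η → η < 1 → 0 < δ → δ < 1 →
          ∀ k₀ : ℕ, TMFG.l1Dist (g.modTBR z₀ μ₀ k₀).1 zStar ≤ η →
          ∀ I₀ : ℕ, c * g.sampleBound C₁ C₂ C₃ w η δ k₀ ≤ I₀ →
            ENNReal.ofReal (1 - δ) ≤
              (g.onlineLaw w I₀ z₀ μ₀ k₀).toOuterMeasure
                {x | TMFG.l1Dist x.1 zStar ≤ 2 * η}) := by
  have h1w : 0 < 1 - w := sub_pos.2 hw'
  have hp : (0 : ℝ) < 32 ^ (1 / (1 - w)) := by positivity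
  -- The first term serves the noise estimate; the second makes `c ^ (1 - w) ≥ 32`, for the initial
  -- bias.
  refine ⟨10 ^ 12 + 32 ^ (1 / (1 - w)), by positivity, ?_⟩
  intro S A _ _ _ _ _ _ g C₁ C₂ C₃ hg hL
  refine ⟨fun z₀ μ₀ hz₀ hμ₀ hbr => g.exists_isTMFE_tendsto_modTBR hg hL hz₀ hμ₀ hbr, ?_⟩
  intro z₀ μ₀ z μ _ η δ hη hη' hδ hδ' k₀ hk₀ I hI
  refine g.onlineLaw_accuracy hL hw hw' (by linarith) ?_ z₀ μ₀ z hη hη' hδ hδ' hk₀ hI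
  calc (32 : ℝ) = ((32 : ℝ) ^ (1 / (1 - w))) ^ (1 - w) := by
        rw [← Real.rpow_mul (by norm_num), one_div_mul_cancel h1w.ne', Real.rpow_one]
    _ ≤ _ := Real.rpow_le_rpow hp.le (by linarith) h1w.le
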